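/- Let $v_1,\dots,v_m\in\mathbb{Z}^n$ be in general position, i.e., every $n$ of them are linearly independent, and suppose that the zonotope $$Z=\Big\{\sum_{i=1}^m\alpha_i v_i : 0\le\alpha_i\le 1\Big\}\subset\mathbb{R}^n$$ has non-empty interior. Let $\mathrm{g}_0(Z),\dots,\mathrm{g}_n(Z)$ be the Ehrhart coefficients of $Z$, i.e., the unique real numbers with $$\#(kZ\cap\mathbb{Z}^n)=\sum_{i=0}^n \mathrm{g}_i(Z)\,k^i\qquad\text{for all integers } k\ge 0$$ (that the lattice point count has this form is part of the assertion). For $1\le j\le n$ let $$\lambda_j=\min\{\lambda>0 : \dim(\lambda (Z-Z)\cap\mathbb{Z}^n)\ge j\}$$ be the successive minima of the difference body $Z-Z$, where $\dim$ is the dimension of the affine hull, and let $$\sigma_i(Z)=\sum_{I\subseteq\{1,\dots,n\},\,\#I=i}\ \prod_{j\in I}\frac1{\lambda_j}.$$ Then, for $1\le i\le n$, $$\mathrm{g}_i(Z)\le\frac{\binom{m}{i}}{\binom{n}{i}}\,\sigma_i(Z).$$ -/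

import Mathlib

open scoped Pointwise

namespace LatticeZonotope

/-- The integer lattice `ℤⁿ` as a subset of `ℝⁿ`. -/
def integerLattice (n : ℕ) : Set (Fin n → ℝ) :=
  {x | ∀ j, ∃ z : ℤ, x j = (z : ℝ)}

/-- The lattice point enumerator `G(K) = #(K ∩ ℤⁿ)` (of a bounded set `K`). -/
noncomputable def latticePointCount {n : ℕ} (K : Set (Fin n → ℝ)) : ℕ :=
  (K ∩ integerLattice n).ncard

/-- `p` is the Ehrhart polynomial of `P`: `G(kP) = p(k)` for all `k ∈ ℕ`.
There is at most one such `p`, since two of them agree at infinitely many points. -/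
def IsEhrhartPolynomial {n : ℕ} (P : Set (Fin n → ℝ)) (p : Polynomial ℝ) : Prop :=
  ∀ k : ℕ, (latticePointCount ((k : ℝ) • P) : ℝ) = p.eval (k : ℝ)

open Classical in
/-- The Ehrhart polynomial of `P` (zero if `P` has none). -/
noncomputable def ehrhartPolynomial {n : ℕ} (P : Set (Fin n → ℝ)) : Polynomial ℝ :=
  if h : ∃ p : Polynomial ℝ, IsEhrhartPolynomial P p then h.choose else 0

/-- The `i`-th Ehrhart coefficient `g_i(P)`. -/
noncomputable def ehrhartCoeff {n : ℕ} (i : ℕ) (P : Set (Fin n → ℝ)) : ℝ :=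
  (ehrhartPolynomial P).coeff i

/-- The dimension of the affine hull of a (nonempty) set. -/
noncomputable def affineDim {n : ℕ} (S : Set (Fin n → ℝ)) : ℕ :=
  Module.finrank ℝ (affineSpan ℝ S).direction

/-- Minkowski's `i`-th successive minimum with respect to `ℤⁿ`,
`λ_i(K) = min {t > 0 : dim (tK ∩ ℤⁿ) ≥ i}`; for a `0`-symmetric convex body `K` and `1 ≤ i ≤ n`
the infimum is over a nonempty set and is attained. -/
noncomputable def successiveMinimum {n : ℕ} (i : ℕ) (K : Set (Fin n → ℝ)) : ℝ :=
  sInf {t : ℝ | 0 < t ∧ i ≤ affineDim (t • K ∩ integerLattice n)}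

/-- The `i`-th elementary symmetric polynomial of `n` real numbers. -/
def elementarySymm {n : ℕ} (i : ℕ) (x : Fin n → ℝ) : ℝ :=
  ∑ I ∈ (Finset.univ : Finset (Fin n)).powersetCard i, ∏ j ∈ I, x j

/-- `σ_i(P) = σ_i(1 / λ_1(DP), …, 1 / λ_n(DP))`, where `DP = P - P`. The indices `j : Fin n` start
at `0`, so that `λ_{j+1}` stands at position `j`. -/
noncomputable def sigma {n : ℕ} (i : ℕ) (P : Set (Fin n → ℝ)) : ℝ :=
  elementarySymm i (fun j : Fin n => 1 / successiveMinimum ((j : ℕ) + 1) (P - P))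

/-- An integer vector regarded as a vector of `ℝⁿ`. -/
def toReal {n : ℕ} (z : Fin n → ℤ) : Fin n → ℝ := fun j => (z j : ℝ)

/-- The zonotope `∑ [0, v_i] = {∑ α_i v_i : 0 ≤ α_i ≤ 1}` generated by `v_1, …, v_m`. -/
def zonotope {m n : ℕ} (v : Fin m → Fin n → ℤ) : Set (Fin n → ℝ) :=
  {x | ∃ α : Fin m → ℝ, (∀ i, 0 ≤ α i ∧ α i ≤ 1) ∧ x = ∑ i, α i • toReal (v i)}

/-- General position: every `n` of the vectors `v_1, …, v_m` are linearly independent. -/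
def InGeneralPosition {m n : ℕ} (v : Fin m → Fin n → ℤ) : Prop :=
  ∀ J : Finset (Fin m), J.card = n → LinearIndependent ℝ (fun j : J => toReal (v j))

end LatticeZonotope

namespace LatticeZonotope

open MeasureTheory

/-! For a set I of generators let b(I) be the number of lattice points in the half-open
parallelepiped spanned by I. By deletion and contraction, the lattice points of Z number the sum of
b(I) over the linearly independent I (`encard_zonotope_inter`). Replacing every v_i by k v_i
multiplies b(I) by k^#I (`boxCount_natCast_smul`), and in general position I is independent exactly
when #I ≤ n. Hence g_i is the sum of b(I) over all I with i elements.

The bound on b(I) is a form of Minkowski's second theorem (`boxCount_mul_prod_le`): every n-set J of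
generators can be ordered so that, for all T ⊆ {1,…,n} at once, the generators in positions T
satisfy b ≤ ∏_{l∈T} 1/λ_l. In coordinates with respect to I, let L ⊇ ℤ^I be the lattice of
coefficient vectors of integral points; its index over ℤ^I is b(I). The points of L with all |x_i| <
λ_{k+1} map into a space W_k of dimension at most k, and J is ordered so that W_k meets the span of
the generators in positions beyond k only in 0 (`exists_flag_complement`). A set of points
incongruent modulo L is grown from a small cube by stretching it by λ_{k+1}/λ_k transversally to W_k
(`exists_isSeparated_dilation`), until its volume is at least the product of the minima. Its b(I)
translates by representatives of L/ℤ^I are incongruent modulo ℤ^I, so their total volume is at most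
1.

Summing over the i-subsets of a fixed J gives at most σ_i. Averaging over all J yields the binomial
factor. -/

/-! ### Separated sets and their volume -/

/-- Distinct points of `D` are incongruent modulo `L`. -/
def IsSeparated {E : Type*} [AddCommGroup E] (L : AddSubgroup E) (D : Set E) : Prop :=
  ∀ x ∈ D, ∀ y ∈ D, x - y ∈ L → x = y

theorem exists_projection_dilation {E : Type*} [AddCommGroup E] [Module ℝ E]
    [FiniteDimensional ℝ E] (U : Submodule ℝ E) (c : ℝ) :
    ∃ p ψ : E →ₗ[ℝ] E, (∀ x, p x ∈ U) ∧ (∀ x ∈ U, p x = x) ∧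
      (∀ x, ψ x = p x + c • (x - p x)) ∧
      LinearMap.det ψ = c ^ (Module.finrank ℝ E - Module.finrank ℝ U) := by
  obtain ⟨W, hW⟩ := Submodule.exists_isCompl U
  let e := Submodule.prodEquivOfIsCompl U W hW
  have he : ∀ y : U × W, e y = (y.1 : E) + y.2 := fun _ => rfl
  have hs : ∀ x : E, x = ((e.symm x).1 : E) + (e.symm x).2 := fun x => by
    rw [← he, e.apply_symm_apply]
  refine ⟨U.subtype ∘ₗ LinearMap.fst ℝ U W ∘ₗ e.symm.toLinearMap,
    e.toLinearMap ∘ₗ (LinearMap.prodMap LinearMap.id (c • LinearMap.id)) ∘ₗ e.symm.toLinearMap,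
    fun x => by simp, fun x hx => ?_, fun x => ?_, ?_⟩
  · have : e.symm x = (⟨x, hx⟩, 0) := by
      rw [LinearEquiv.symm_apply_eq, he]; simp
    simp [this]
  · have h2 : x - ((e.symm x).1 : E) = (e.symm x).2 := by
      nth_rewrite 1 [hs x]; abel
    simp only [LinearMap.comp_apply, LinearEquiv.coe_coe, he, LinearMap.prodMap_apply,
      LinearMap.fst_apply, Submodule.subtype_apply, h2]
    simp
  · rw [LinearMap.det_conj, LinearMap.det_prodMap, LinearMap.det_id, LinearMap.det_smul,
      LinearMap.det_id, mul_one, one_mul]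
    congr 1
    have := Submodule.finrank_add_eq_of_isCompl hW
    omega

/-- Stretch `D` by `c` transversally to `U` only, and translate along `U`, coset by coset, so that
the image lands in `B`. Congruent image points differ by an element of `U`, so they come from one
coset of `U`, where the map is a translation and preserves incongruence. -/
theorem exists_isSeparated_dilation {E : Type*} [NormedAddCommGroup E] [NormedSpace ℝ E]
    [MeasurableSpace E] [BorelSpace E] [FiniteDimensional ℝ E] (μ : Measure E)
    [μ.IsAddHaarMeasure] {A B : Set E} {c : ℝ} (hc : 1 ≤ c) (hAo : IsOpen A) (hAc : Convex ℝ A)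
    (hAB : ∀ x ∈ A, c • x ∈ B) (L : AddSubgroup E) (U : Submodule ℝ E)
    (hU : ∀ x ∈ B, ∀ y ∈ B, x - y ∈ L → x - y ∈ U) {D : Set E} (hD : MeasurableSet D)
    (hDA : D ⊆ A) (hDL : IsSeparated L D) :
    ∃ D' : Set E, MeasurableSet D' ∧ D' ⊆ B ∧ IsSeparated L D' ∧
      μ D' = ENNReal.ofReal (c ^ (Module.finrank ℝ E - Module.finrank ℝ U)) * μ D := by
  obtain ⟨p, ψ, hpU, hp, hψ, hdet⟩ := exists_projection_dilation U c
  have hc0 : 0 < c := by linarith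
  -- Each coset of `U` meeting `A` needs an anchor point in `A`. Since `A` is open, anchors over a
  -- countable dense subset of `U` suffice, which keeps the pieces and the map measurable.
  let r : ℕ → U := TopologicalSpace.denseSeq U
  let O : ℕ → Set E := fun k => {x | (r k : E) + (x - p x) ∈ A}
  have hpc : Continuous p := p.continuous_of_finiteDimensional
  have hOo : ∀ k, IsOpen (O k) := fun k => hAo.preimage (by fun_prop)
  have hO : ∀ x ∈ A, ∃ k, x ∈ O k := by
    intro x hx
    have hopen : IsOpen {u : U | (u : E) + (x - p x) ∈ A} := hAo.preimage (by fun_prop)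
    exact (TopologicalSpace.denseRange_denseSeq U).exists_mem_open hopen
      ⟨⟨p x, hpU x⟩, by simpa using hx⟩
  have hOeq : ∀ k x y, x - p x = y - p y → (x ∈ O k ↔ y ∈ O k) := by
    intro k x y h; simp only [O, Set.mem_ofPred_eq, h]
  have hdis : ∀ k x y, x - p x = y - p y → x ∈ disjointed O k → y ∈ disjointed O k := by
    intro k x y h
    simp only [disjointed_apply, Set.mem_sdiff, Finset.sup_set_eq_biUnion, Set.mem_iUnion,
      not_exists, hOeq _ x y h, imp_self]
  -- This is `c` times the convex combination of `x` and the anchor `r k + (x - p x)` with weights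
  -- `c⁻¹` and `1 - c⁻¹`, so it lies in `c • A`.
  let Θ : ℕ → E → E := fun k x => (c - 1) • (r k : E) + ψ x
  let P : ℕ → Set E := fun k => D ∩ disjointed O k
  have hΘB : ∀ k, ∀ x ∈ P k, Θ k x ∈ B := by
    rintro k x ⟨hx, hxk⟩
    have h1 : x ∈ A := hDA hx
    have h2 : (r k : E) + (x - p x) ∈ A := disjointed_subset O k hxk
    have h3 := hAB _ (hAc h1 h2 (a := c⁻¹) (b := 1 - c⁻¹) (by positivity)
      (by linarith [inv_le_one_of_one_le₀ hc]) (by ring))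
    convert h3 using 1
    simp only [Θ, hψ]
    match_scalars <;> field_simp <;> ring
  have hsep : ∀ i, ∀ x ∈ P i, ∀ j, ∀ y ∈ P j, Θ i x - Θ j y ∈ L → i = j ∧ x = y := by
    rintro i x hx j y hy h
    have h1 := hU _ (hΘB i x hx) _ (hΘB j y hy) h
    have h2 : x - p x = y - p y := by
      have h3 : p ((x - p x) - (y - p y)) = 0 := by
        simp [map_sub, hp _ (hpU x), hp _ (hpU y)]
      have h4 : c • ((x - p x) - (y - p y)) ∈ U := by
        have : c • ((x - p x) - (y - p y)) = (Θ i x - Θ j y) -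
          ((c - 1) • (r i : E) + p x - ((c - 1) • (r j : E) + p y)) := by
          simp only [Θ, hψ]; module
        rw [this]
        exact U.sub_mem h1 (U.sub_mem (U.add_mem (U.smul_mem _ (r i).2) (hpU x))
          (U.add_mem (U.smul_mem _ (r j).2) (hpU y)))
      have h5 : (x - p x) - (y - p y) ∈ U := by
        have := U.smul_mem c⁻¹ h4
        rwa [smul_smul, inv_mul_cancel₀ hc0.ne', one_smul] at this
      have h6 := hp _ h5
      rw [h3] at h6
      exact sub_eq_zero.1 h6.symm
    have hij : i = j := by
      by_contra hne
      exact Set.disjoint_left.1 (disjoint_disjointed O hne) (hdis i x y h2 hx.2) hy.2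
    subst hij
    refine ⟨rfl, hDL x hx.1 y hy.1 ?_⟩
    convert h using 1
    simp only [Θ, hψ, h2]
    have : x - y = p x - p y + ((x - p x) - (y - p y)) := by abel
    rw [this, h2]; abel
  have hψinj : LinearMap.det ψ ≠ 0 := by rw [hdet]; positivity
  let ψe := LinearMap.equivOfDetNeZero ψ hψinj
  have hmeas : ∀ k, MeasurableSet (Θ k '' P k) := by
    intro k
    have hP : MeasurableSet (P k) := hD.inter (.disjointed (fun i => (hOo i).measurableSet) k)
    let f : E ≃ₜ E := ψe.toContinuousLinearEquiv.toHomeomorph.trans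
      (Homeomorph.addLeft ((c - 1) • (r k : E)))
    have : Θ k = f := rfl
    rw [this]
    exact f.measurableEmbedding.measurableSet_image.2 hP
  refine ⟨⋃ k, Θ k '' P k, .iUnion hmeas, ?_, ?_, ?_⟩
  · rintro _ ⟨_, ⟨k, rfl⟩, x, hx, rfl⟩
    exact hΘB k x hx
  · rintro _ ⟨_, ⟨i, rfl⟩, x, hx, rfl⟩ _ ⟨_, ⟨j, rfl⟩, y, hy, rfl⟩ h
    obtain ⟨rfl, rfl⟩ := hsep i x hx j y hy h
    rfl
  · have hdisj : Pairwise (Function.onFun Disjoint fun k => Θ k '' P k) := by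
      intro i j hij
      refine Set.disjoint_left.2 ?_
      rintro _ ⟨x, hx, rfl⟩ ⟨y, hy, hxy⟩
      exact hij (hsep i x hx j y hy (by rw [hxy, sub_self]; exact L.zero_mem)).1
    have hcov : D = ⋃ k, P k := by
      simp only [P, ← Set.inter_iUnion, iUnion_disjointed]
      refine (Set.inter_eq_left.2 fun x hx => ?_).symm
      obtain ⟨k, hk⟩ := hO x (hDA hx)
      exact Set.mem_iUnion.2 ⟨k, hk⟩
    rw [measure_iUnion hdisj hmeas]
    conv_rhs => rw [hcov]
    rw [measure_iUnion, ← ENNReal.tsum_mul_left]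
    · congr 1 with k
      have : Θ k '' P k = (fun x => (c - 1) • (r k : E) + x) '' (ψ '' P k) := by
        rw [Set.image_image]
      rw [this, Set.image_add_left, measure_preimage_add, Measure.addHaar_image_linearMap, hdet,
        abs_of_nonneg (by positivity)]
    · exact fun i j hij => (disjoint_disjointed O hij).mono Set.inter_subset_right
        Set.inter_subset_right
    · exact fun k => hD.inter (.disjointed (fun i => (hOo i).measurableSet) k)

/-- Induction on `k`, passing from the cube of side `μ k` to that of side `μ (k + 1)` by a dilation
transversal to `U (k + 1)`. The start is the whole cube of side `μ 0`, which is separated because `U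
0 = ⊥`. -/
theorem exists_isSeparated_volume_ge {ι : Type*} [Fintype ι] {n : ℕ} {μ : ℕ → ℝ}
    (hpos : ∀ k < n, 0 < μ k) (hmono : ∀ k, k + 1 < n → μ k ≤ μ (k + 1))
    (e : ι → ℕ) (L : AddSubgroup (ι → ℝ)) (U : ℕ → Submodule ℝ (ι → ℝ))
    (hU : ∀ k < n, Module.finrank ℝ (U k) ≤ (Finset.univ.filter fun i => e i < k).card)
    (hL : ∀ k < n, ∀ x ∈ L, (∀ i, |x i| < μ k) → x ∈ U k) (k : ℕ) (hk : k < n) :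
    ∃ D : Set (ι → ℝ), MeasurableSet D ∧ D ⊆ Set.univ.pi (fun _ => Set.Ioo 0 (μ k)) ∧
      IsSeparated L D ∧ ENNReal.ofReal (∏ i, μ (min (e i) k)) ≤ volume D := by
  have hU' : ∀ k < n, ∀ x ∈ Set.univ.pi (fun _ : ι => Set.Ioo 0 (μ k)),
      ∀ y ∈ Set.univ.pi (fun _ : ι => Set.Ioo 0 (μ k)), x - y ∈ L → x - y ∈ U k := by
    intro k hk x hx y hy h
    refine hL k hk _ h fun i => ?_
    have h1 := hx i trivial
    have h2 := hy i trivial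
    rw [Pi.sub_apply, abs_lt]
    constructor <;> linarith [h1.1, h1.2, h2.1, h2.2]
  induction k with
  | zero =>
    refine ⟨Set.univ.pi (fun _ => Set.Ioo 0 (μ 0)),
      MeasurableSet.univ_pi fun _ => measurableSet_Ioo, subset_rfl, fun x hx y hy h => ?_, ?_⟩
    · have h0 : U 0 = ⊥ := Submodule.finrank_eq_zero.1 (by simpa using hU 0 hk)
      have := hU' 0 hk x hx y hy h
      rw [h0, Submodule.mem_bot] at this
      exact sub_eq_zero.1 this
    · have := Real.volume_pi_Ioo (a := fun _ : ι => (0 : ℝ)) (b := fun _ => μ 0)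
      rw [this]
      simp only [Nat.min_zero, sub_zero]
      rw [ENNReal.ofReal_prod_of_nonneg fun _ _ => (hpos 0 hk).le]
  | succ k ih =>
    obtain ⟨D, hD, hDs, hDL, hDv⟩ := ih (by omega)
    have hk0 := hpos k (by omega)
    have hc : 1 ≤ μ (k + 1) / μ k := (one_le_div hk0).2 (hmono k hk)
    have hsc : ∀ x ∈ Set.univ.pi (fun _ : ι => Set.Ioo 0 (μ k)),
        (μ (k + 1) / μ k) • x ∈ Set.univ.pi (fun _ : ι => Set.Ioo 0 (μ (k + 1))) := by
      intro x hx i _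
      have h1 := hx i trivial
      rw [Pi.smul_apply, smul_eq_mul]
      refine ⟨mul_pos (by linarith) h1.1, ?_⟩
      rw [div_mul_eq_mul_div, div_lt_iff₀ hk0]
      exact mul_lt_mul_of_pos_left h1.2 (hpos _ hk)
    obtain ⟨D', hD', hs', hL', hv'⟩ := exists_isSeparated_dilation volume hc
      (A := Set.univ.pi (fun _ : ι => Set.Ioo 0 (μ k)))
      (B := Set.univ.pi (fun _ : ι => Set.Ioo 0 (μ (k + 1))))
      (isOpen_set_pi Set.finite_univ fun _ _ => isOpen_Ioo)
      (convex_pi fun _ _ => convex_Ioo 0 _) hsc L (U (k + 1)) (hU' _ hk)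
      hD hDs hDL
    refine ⟨D', hD', hs', hL', ?_⟩
    rw [hv']
    refine le_trans ?_ (mul_le_mul_right hDv _)
    rw [← ENNReal.ofReal_mul (by positivity)]
    refine ENNReal.ofReal_le_ofReal ?_
    -- Only the factors with `k + 1 ≤ e i` grow, each by the dilation ratio. Their number is at most
    -- the codimension of `U (k + 1)`, and the ratio is at least 1.
    have h1 : ∏ i, μ (min (e i) (k + 1)) =
        (∏ i, if k + 1 ≤ e i then μ (k + 1) / μ k else 1) * ∏ i, μ (min (e i) k) := by
      rw [← Finset.prod_mul_distrib]
      refine Finset.prod_congr rfl fun i _ => ?_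
      split_ifs with h
      · rw [min_eq_right h, min_eq_right (by omega), div_mul_cancel₀ _ hk0.ne']
      · rw [min_eq_left (by omega), min_eq_left (by omega), one_mul]
    rw [h1, ← Finset.prod_filter, Finset.prod_const]
    refine mul_le_mul_of_nonneg_right (pow_le_pow_right₀ hc ?_)
      (Finset.prod_nonneg fun i _ => (hpos _ (by omega)).le)
    have h2 := hU (k + 1) hk
    have h3 := Finset.card_filter_add_card_filter_not (s := Finset.univ)
      (fun i : ι => e i < k + 1)
    simp only [not_lt, Finset.card_univ] at h3
    rw [Module.finrank_fintype_fun_eq_card]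
    omega

/-- Blichfeldt's principle for the integer lattice, whose fundamental domain is the unit cube. -/
theorem volume_le_one_of_isSeparated {ι : Type*} [Fintype ι] {D : Set (ι → ℝ)}
    (hD : MeasurableSet D)
    (hs : ∀ x ∈ D, ∀ y ∈ D, (∀ i, ∃ z : ℤ, x i - y i = z) → x = y) : volume D ≤ 1 := by
  classical
  by_contra! h
  let b := Pi.basisFun ℝ ι
  have hF : volume (ZSpan.fundamentalDomain b) = 1 := by
    rw [ZSpan.volume_fundamentalDomain]
    have : Matrix.of (b : ι → ι → ℝ) = 1 := by
      ext i j
      simp [b, Pi.basisFun_apply, Matrix.one_apply, Pi.single_apply, eq_comm]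
    simp [this]
  rw [← hF] at h
  have : Countable (Submodule.span ℤ (Set.range b)).toAddSubgroup :=
    inferInstanceAs (Countable (Submodule.span ℤ (Set.range b)))
  obtain ⟨x, y, hxy, hd⟩ := exists_pair_mem_lattice_not_disjoint_vadd
    (L := (Submodule.span ℤ (Set.range b)).toAddSubgroup)
    (ZSpan.isAddFundamentalDomain' b volume) hD.nullMeasurableSet h
  obtain ⟨w, ⟨a, ha, rfl⟩, a', ha', haa⟩ := Set.not_disjoint_iff.1 hd
  have haa' : (y : ι → ℝ) + a' = x + a := haa
  have hint : ∀ z ∈ Submodule.span ℤ (Set.range b), ∀ i, ∃ k : ℤ, z i = k := by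
    intro z hz i
    obtain ⟨c, hc⟩ := b.mem_span_iff_repr_mem ℤ z |>.1 hz i
    exact ⟨c, by simpa [b] using hc.symm⟩
  have h1 : a = a' := by
    refine hs a ha a' ha' fun i => ?_
    obtain ⟨k, hk⟩ := hint (y - x) (Submodule.sub_mem _ y.2 x.2) i
    refine ⟨k, ?_⟩
    have := congrFun haa' i
    simp only [Pi.add_apply, Pi.sub_apply] at this hk
    rw [← hk]; linarith
  subst h1
  exact hxy (Subtype.ext (add_right_cancel haa').symm)

/-- The points of `L` in the half-open unit cube represent the cosets of the integer lattice in `L`.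
Translating `D` by them gives disjoint sets whose union is separated modulo the integer lattice.
Working with finite sets of representatives also yields finiteness. -/
theorem ncard_mul_le_one {ι : Type*} [Fintype ι] (L : AddSubgroup (ι → ℝ))
    (hL : ∀ x : ι → ℝ, (∀ i, ∃ z : ℤ, x i = z) → x ∈ L) {D : Set (ι → ℝ)} (hD : MeasurableSet D)
    (hDL : IsSeparated L D) {r : ℝ} (hr : 0 < r) (hrD : ENNReal.ofReal r ≤ volume D) :
    {x : ι → ℝ | (∀ i, 0 ≤ x i ∧ x i < 1) ∧ x ∈ L}.Finite ∧
    ({x : ι → ℝ | (∀ i, 0 ≤ x i ∧ x i < 1) ∧ x ∈ L}.ncard : ℝ) * r ≤ 1 := by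
  have key : ∀ F : Finset (ι → ℝ), (F : Set (ι → ℝ)) ⊆
      {x : ι → ℝ | (∀ i, 0 ≤ x i ∧ x i < 1) ∧ x ∈ L} → (F.card : ℝ) * r ≤ 1 := by
    intro F hF
    have hm : ∀ f ∈ F, MeasurableSet ((fun x => f + x) '' D) := fun f _ =>
      (Homeomorph.addLeft f).measurableEmbedding.measurableSet_image.2 hD
    have hsep : ∀ f ∈ F, ∀ g ∈ F, ∀ x ∈ D, ∀ y ∈ D,
        (∀ i, ∃ z : ℤ, (f + x) i - (g + y) i = z) → f = g ∧ x = y := by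
      intro f hf g hg x hx y hy h
      -- Separation modulo `L` first identifies the points of `D`; the two representatives then
      -- differ by an integer vector with entries in (-1, 1).
      have hxy : x = y := by
        refine hDL x hx y hy ?_
        have h1 := L.add_mem (hL (f + x - (g + y)) h) (L.sub_mem (hF hg).2 (hF hf).2)
        convert h1 using 1; abel
      subst hxy
      refine ⟨funext fun i => ?_, rfl⟩
      obtain ⟨z, hz⟩ := h i
      simp only [Pi.add_apply, add_sub_add_right_eq_sub] at hz
      have h1 := (hF hf).1 i
      have h2 := (hF hg).1 i
      have h3 : z < 1 := by exact_mod_cast (by linarith [h1.2, h2.1] : (z : ℝ) < 1)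
      have h4 : -1 < z := by exact_mod_cast (by linarith [h1.1, h2.2] : (-1 : ℝ) < z)
      have : z = 0 := by omega
      subst this
      simpa [sub_eq_zero] using hz
    have hv := volume_le_one_of_isSeparated (D := ⋃ f ∈ F, (fun x => f + x) '' D)
      (F.measurableSet_biUnion hm) (by
        intro x hx y hy h
        simp only [Set.mem_iUnion] at hx hy
        obtain ⟨f, hf, x, hx, rfl⟩ := hx
        obtain ⟨g, hg, y, hy, rfl⟩ := hy
        obtain ⟨rfl, rfl⟩ := hsep f hf g hg x hx y hy h
        rfl)
    rw [measure_biUnion_finset (by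
      intro f hf g hg hfg
      refine Set.disjoint_left.2 ?_
      rintro _ ⟨x, hx, rfl⟩ ⟨y, hy, h⟩
      exact hfg (hsep f hf g hg x hx y hy fun i =>
        ⟨0, by
          have : g + y = f + x := h
          rw [this]; simp⟩).1) hm] at hv
    simp only [Set.image_add_left, measure_preimage_add, Finset.sum_const, nsmul_eq_mul] at hv
    have h1 : (F.card : ENNReal) * ENNReal.ofReal r ≤ 1 :=
      (mul_le_mul_right hrD _).trans hv
    rw [← ENNReal.ofReal_natCast, ← ENNReal.ofReal_mul (by positivity)] at h1
    exact (ENNReal.ofReal_le_one).1 h1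
  have hfin : {x : ι → ℝ | (∀ i, 0 ≤ x i ∧ x i < 1) ∧ x ∈ L}.Finite := by
    by_contra hinf
    obtain ⟨N, hN⟩ := exists_nat_gt (1 / r)
    obtain ⟨F, hF, hc⟩ := Set.Infinite.exists_subset_card_eq hinf N
    have := key F hF
    rw [hc] at this
    rw [div_lt_iff₀ hr] at hN
    linarith
  refine ⟨hfin, ?_⟩
  have := key hfin.toFinset (by simp)
  rwa [Set.ncard_eq_toFinset_card _ hfin]

/-! ### Counting lattice points of zonotopes by deletion and contraction -/

section DeletionContraction

variable {E ι : Type*} [NormedAddCommGroup E] [NormedSpace ℝ E]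

/-- The sum of the zonotope generated by `v i`, `i ∈ A`, and the linear span of `v i`, `i ∈ B`. -/
def zonotopeAddSpan (v : ι → E) (A B : Finset ι) : Set E :=
  {x | ∃ α : ι → ℝ, (∀ i, 0 ≤ α i ∧ α i ≤ 1) ∧
    x - ∑ i ∈ A, α i • v i ∈ Submodule.span ℝ (v '' B)}

/-- The number of orbits of the lattice points of `zonotopeAddSpan v A B` under translation by the
group generated by `v i`, `i ∈ B`. -/
noncomputable def orbitCount (v : ι → E) (L : AddSubgroup E) (A B : Finset ι) : ℕ∞ :=
  ((QuotientAddGroup.mk : E → E ⧸ AddSubgroup.closure (v '' B)) ''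
    (zonotopeAddSpan v A B ∩ L)).encard

/-- The number of lattice points in the half-open parallelepiped spanned by `v i`, `i ∈ I`, in
coordinates with respect to the `v i`. -/
noncomputable def boxCount (v : ι → E) (L : AddSubgroup E) (I : Finset ι) : ℕ∞ :=
  {β : I → ℝ | (∀ i, 0 ≤ β i ∧ β i < 1) ∧ ∑ i, β i • v i ∈ L}.encard

theorem closure_le_span (v : ι → E) (B : Finset ι) {x : E}
    (hx : x ∈ AddSubgroup.closure (v '' B)) : x ∈ Submodule.span ℝ (v '' B) := by
  have : AddSubgroup.closure (v '' B) ≤ (Submodule.span ℝ (v '' B)).toAddSubgroup :=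
    (AddSubgroup.closure_le _).2 Submodule.subset_span
  exact this hx

theorem mem_zonotopeAddSpan_congr {v : ι → E} {A B : Finset ι} {x y : E}
    (h : x - y ∈ Submodule.span ℝ (v '' B)) :
    x ∈ zonotopeAddSpan v A B ↔ y ∈ zonotopeAddSpan v A B := by
  have : ∀ {x y : E}, x - y ∈ Submodule.span ℝ (v '' B) → x ∈ zonotopeAddSpan v A B →
      y ∈ zonotopeAddSpan v A B := by
    rintro x y h ⟨α, hα, hx⟩
    refine ⟨α, hα, ?_⟩
    convert Submodule.sub_mem _ hx h using 1
    abel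
  exact ⟨this h, this (by rw [← neg_sub]; exact Submodule.neg_mem _ h)⟩

theorem isClosed_zonotopeAddSpan [FiniteDimensional ℝ E] (v : ι → E) (A B : Finset ι) :
    IsClosed (zonotopeAddSpan v A B) := by
  have hK : IsCompact ((fun α : ι → ℝ => ∑ i ∈ A, α i • v i) ''
      (Set.univ.pi fun _ => Set.Icc 0 1)) :=
    (isCompact_univ_pi fun _ => isCompact_Icc).image (by fun_prop)
  have := (Submodule.closed_of_finiteDimensional (Submodule.span ℝ (v '' B))).add_left_of_isCompact
    hK
  convert this using 1
  ext x
  constructor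
  · rintro ⟨α, hα, hx⟩
    exact ⟨_, ⟨α, fun i _ => hα i, rfl⟩, _, hx, by simp⟩
  · rintro ⟨_, ⟨α, hα, rfl⟩, y, hy, rfl⟩
    exact ⟨α, fun i => hα i trivial, by simpa using hy⟩

theorem convex_zonotopeAddSpan (v : ι → E) (A B : Finset ι) :
    Convex ℝ (zonotopeAddSpan v A B) := by
  rintro x ⟨α, hα, hx⟩ y ⟨β, hβ, hy⟩ a b ha hb hab
  refine ⟨fun i => a * α i + b * β i, fun i => ⟨?_, ?_⟩, ?_⟩
  · have := (hα i).1; have := (hβ i).1; positivity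
  · nlinarith [(hα i).2, (hβ i).2]
  · convert Submodule.add_mem _ (Submodule.smul_mem _ a hx) (Submodule.smul_mem _ b hy) using 1
    simp only [add_smul, mul_smul, Finset.sum_add_distrib, ← Finset.smul_sum]
    module

variable [DecidableEq ι]

theorem mem_zonotopeAddSpan_insert_left {v : ι → E} {A B : Finset ι} {a : ι} (ha : a ∉ A) {x : E} :
    x ∈ zonotopeAddSpan v (insert a A) B ↔
      ∃ θ : ℝ, 0 ≤ θ ∧ θ ≤ 1 ∧ x - θ • v a ∈ zonotopeAddSpan v A B := by
  constructor
  · rintro ⟨α, hα, hx⟩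
    refine ⟨α a, (hα a).1, (hα a).2, α, hα, ?_⟩
    rwa [Finset.sum_insert ha, ← sub_sub] at hx
  · rintro ⟨θ, h0, h1, α, hα, hx⟩
    refine ⟨Function.update α a θ, fun i => ?_, ?_⟩
    · by_cases hi : i = a
      · subst hi; simp [h0, h1]
      · simpa [hi] using hα i
    · rw [Finset.sum_insert ha, Function.update_self, ← sub_sub]
      convert hx using 2
      refine Finset.sum_congr rfl fun i hi => ?_
      rw [Function.update_of_ne (ne_of_mem_of_not_mem hi ha)]

theorem mem_zonotopeAddSpan_insert_right {v : ι → E} {A B : Finset ι} {a : ι} {x : E} :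
    x ∈ zonotopeAddSpan v A (insert a B) ↔ ∃ r : ℝ, x + r • v a ∈ zonotopeAddSpan v A B := by
  simp only [zonotopeAddSpan, Set.mem_ofPred_eq, Finset.coe_insert, Set.image_insert_eq,
    Submodule.mem_span_insert]
  constructor
  · rintro ⟨α, hα, r, z, hz, hx⟩
    refine ⟨-r, α, hα, ?_⟩
    have : x + -r • v a - ∑ i ∈ A, α i • v i = z := by
      rw [add_sub_right_comm, hx]; module
    rwa [this]
  · rintro ⟨r, α, hα, hx⟩
    exact ⟨α, hα, -r, _, hx, by module⟩

theorem mem_closure_insert {v : ι → E} {B : Finset ι} {a : ι} {x : E} :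
    x ∈ AddSubgroup.closure (v '' (insert a B : Finset ι)) ↔
      ∃ h ∈ AddSubgroup.closure (v '' B), ∃ k : ℤ, x = h + (k : ℝ) • v a := by
  rw [Finset.coe_insert, Set.image_insert_eq, Set.insert_eq, AddSubgroup.closure_union,
    sup_comm, AddSubgroup.mem_sup]
  simp only [AddSubgroup.mem_closure_singleton, Int.cast_smul_eq_zsmul]
  constructor
  · rintro ⟨h, hh, _, ⟨k, rfl⟩, rfl⟩
    exact ⟨h, hh, k, rfl⟩
  · rintro ⟨h, hh, k, rfl⟩
    exact ⟨h, hh, _, ⟨k, rfl⟩, rfl⟩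

theorem orbitCount_insert_of_mem {v : ι → E} {L : AddSubgroup E}
    {A B : Finset ι} {a : ι} (ha : a ∉ A) (hB : v a ∈ Submodule.span ℝ (v '' B)) :
    orbitCount v L (insert a A) B = orbitCount v L A B := by
  have : zonotopeAddSpan v (insert a A) B = zonotopeAddSpan v A B := by
    ext x
    rw [mem_zonotopeAddSpan_insert_left ha]
    constructor
    · rintro ⟨θ, -, -, h⟩
      exact (mem_zonotopeAddSpan_congr (by simpa using Submodule.smul_mem _ θ hB)).2 h
    · intro h
      exact ⟨0, le_rfl, zero_le_one, by simpa using h⟩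
  rw [orbitCount, orbitCount, this]

/-- Taking fractional parts of the coordinates picks one representative of each orbit in the
half-open parallelepiped. -/
theorem orbitCount_empty {v : ι → E} {L : AddSubgroup E} (hv : ∀ i, v i ∈ L) {B : Finset ι}
    (hB : LinearIndepOn ℝ v (B : Set ι)) : orbitCount v L ∅ B = boxCount v L B := by
  have hmem : ∀ x : E, x ∈ Submodule.span ℝ (v '' B) ↔ ∃ β : B → ℝ, ∑ i, β i • v i = x := 
    fun x => Submodule.mem_span_image_finset_iff_exists_fun ℝ
  have hcl : ∀ β : B → ℤ, ∑ i, (β i : ℝ) • v i ∈ AddSubgroup.closure (v '' B) := fun β =>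
    AddSubgroup.sum_mem _ fun i _ => by
      rw [Int.cast_smul_eq_zsmul]
      exact AddSubgroup.zsmul_mem _ (AddSubgroup.subset_closure (Set.mem_image_of_mem v i.2)) _
  have hcl' : ∀ x ∈ AddSubgroup.closure (v '' B), ∃ β : B → ℤ, ∑ i, (β i : ℝ) • v i = x := by
    intro x hx
    induction hx using AddSubgroup.closure_induction with
    | mem x hx =>
      obtain ⟨i, hi, rfl⟩ := hx
      refine ⟨Pi.single (⟨i, hi⟩ : B) 1, ?_⟩
      rw [Finset.sum_eq_single (⟨i, hi⟩ : B)] <;> simp +contextual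
    | zero => exact ⟨0, by simp⟩
    | add x y _ _ hx hy =>
      obtain ⟨β, rfl⟩ := hx
      obtain ⟨γ, rfl⟩ := hy
      exact ⟨β + γ, by simp [add_smul, Finset.sum_add_distrib]⟩
    | neg x _ hx =>
      obtain ⟨β, rfl⟩ := hx
      exact ⟨-β, by simp⟩
  have hcL : AddSubgroup.closure (v '' B) ≤ L :=
    (AddSubgroup.closure_le _).2 (by rintro _ ⟨i, -, rfl⟩; exact hv i)
  have hli : ∀ β γ : B → ℝ, ∑ i, β i • v i = ∑ i, γ i • v i → β = γ := fun β γ h => by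
    have h1 := Fintype.linearIndependent_iff.1 hB (β - γ) (by
      simpa [sub_smul, sub_eq_zero] using h)
    exact funext fun i => sub_eq_zero.1 (h1 i)
  rw [orbitCount, boxCount]
  symm
  rw [← Set.InjOn.encard_image (f := fun β : B → ℝ =>
    (QuotientAddGroup.mk (∑ i, β i • v i) : E ⧸ AddSubgroup.closure (v '' B)))]
  · congr 1
    ext q
    constructor
    · rintro ⟨β, ⟨-, hβ⟩, rfl⟩
      exact ⟨_, ⟨⟨0, fun i => by simp, by simpa using (hmem _).2 ⟨β, rfl⟩⟩, hβ⟩, rfl⟩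
    · rintro ⟨x, ⟨⟨α, hα, hx⟩, hxL⟩, rfl⟩
      simp only [Finset.sum_empty, sub_zero] at hx
      obtain ⟨β, rfl⟩ := (hmem x).1 hx
      have h1 : ∑ i, β i • v i = ∑ i, Int.fract (β i) • v i + ∑ i, (⌊β i⌋ : ℝ) • v i := by
        rw [← Finset.sum_add_distrib]
        exact Finset.sum_congr rfl fun i _ => by rw [← add_smul, Int.fract_add_floor]
      refine ⟨fun i => Int.fract (β i), ⟨fun i => ⟨Int.fract_nonneg _, Int.fract_lt_one _⟩, ?_⟩, ?_⟩
      · have h2 := L.sub_mem hxL (hcL (hcl fun i => ⌊β i⌋))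
        rwa [h1, add_sub_cancel_right] at h2
      · refine QuotientAddGroup.eq.2 ?_
        rw [h1, neg_add_cancel_left]
        exact hcl _
  · rintro β ⟨hβ, -⟩ γ ⟨hγ, -⟩ h
    obtain ⟨k, hk⟩ := hcl' _ (QuotientAddGroup.eq.1 h)
    have h1 := hli (fun i => β i + k i) γ (by
      simp only [add_smul, Finset.sum_add_distrib]; rw [hk]; simp)
    funext i
    have h2 : β i + k i = γ i := congrFun h1 i
    have h3 : k i < 1 := by
      exact_mod_cast (by linarith [(hβ i).1, (hγ i).2] : (k i : ℝ) < 1)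
    have h4 : -1 < k i := by
      exact_mod_cast (by linarith [(hβ i).2, (hγ i).1] : (-1 : ℝ) < k i)
    have : k i = 0 := by omega
    rw [this] at h2
    simpa using h2

variable [FiniteDimensional ℝ E]

/-- The line meets the smaller set in a closed interval bounded above. Adding the segment from 0 to
`v a` extends it by length 1 at the upper end only, so `b` is its maximum. -/
theorem exists_line_inter_eq_Ioc {v : ι → E} {A B : Finset ι} {a : ι} (ha : a ∉ A)
    (hB : v a ∉ Submodule.span ℝ (v '' B)) {y : E}
    (hy : y ∈ zonotopeAddSpan v A (insert a B)) :
    ∃ b : ℝ, ∀ r : ℝ, (y + r • v a ∈ zonotopeAddSpan v (insert a A) B ∧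
      y + r • v a ∉ zonotopeAddSpan v A B) ↔ b < r ∧ r ≤ b + 1 := by
  let R : Set ℝ := {r | y + r • v a ∈ zonotopeAddSpan v A B}
  have hne : R.Nonempty := mem_zonotopeAddSpan_insert_right.1 hy
  have hcl : IsClosed R := (isClosed_zonotopeAddSpan v A B).preimage (by fun_prop)
  have hconv : ∀ r ∈ R, ∀ s ∈ R, ∀ t, r ≤ t → t ≤ s → t ∈ R := by
    have : Convex ℝ R := by
      intro r hr s hs p q hp hq hpq
      have := convex_zonotopeAddSpan v A B hr hs hp hq hpq
      have h : y + (p • r + q • s) • v a = p • (y + r • v a) + q • (y + s • v a) := by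
        have : y = (p + q) • y := by rw [hpq, one_smul]
        nth_rewrite 1 [this]
        simp only [smul_eq_mul]
        module
      change y + (p • r + q • s) • v a ∈ zonotopeAddSpan v A B
      rwa [h]
    intro r hr s hs t h1 h2
    exact this.ordConnected.out hr hs ⟨h1, h2⟩
  have hbdd : BddAbove R := by
    -- A functional vanishing on the span of `B` but not at `v a` is bounded on the zonotope, hence
    -- bounds `r`.
    obtain ⟨f, hf, hfB⟩ := Submodule.exists_dual_map_eq_bot_of_notMem hB inferInstance
    have hf0 : ∀ x ∈ Submodule.span ℝ (v '' B), f x = 0 := fun x hx => by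
      have := Submodule.mem_map_of_mem (f := f) hx
      rwa [hfB, Submodule.mem_bot] at this
    refine ⟨(∑ i ∈ A, |f (v i)| + |f y|) / |f (v a)|, ?_⟩
    rintro r ⟨α, hα, hr⟩
    have h1 := hf0 _ hr
    simp only [map_sub, map_add, map_smul, map_sum, smul_eq_mul] at h1
    have h2 : r * f (v a) = ∑ i ∈ A, α i * f (v i) - f y := by linarith
    rw [le_div_iff₀ (abs_pos.2 hf)]
    calc r * |f (v a)| ≤ |r * f (v a)| := by rw [abs_mul]; gcongr; exact le_abs_self r
      _ = |∑ i ∈ A, α i * f (v i) - f y| := by rw [h2]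
      _ ≤ |∑ i ∈ A, α i * f (v i)| + |f y| := abs_sub _ _
      _ ≤ ∑ i ∈ A, |f (v i)| + |f y| := by
        gcongr
        refine (Finset.abs_sum_le_sum_abs _ _).trans (Finset.sum_le_sum fun i _ => ?_)
        rw [abs_mul, abs_of_nonneg (hα i).1]
        exact mul_le_of_le_one_left (abs_nonneg _) (hα i).2
  have hb : sSup R ∈ R := hcl.csSup_mem hne hbdd
  refine ⟨sSup R, fun r => ?_⟩
  rw [mem_zonotopeAddSpan_insert_left ha]
  have hshift : ∀ θ : ℝ, y + r • v a - θ • v a = y + (r - θ) • v a := fun θ => by module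
  simp only [hshift]
  constructor
  · rintro ⟨⟨θ, h0, h1, h2⟩, h3⟩
    constructor
    · by_contra! h
      exact h3 (hconv _ h2 _ hb r (by linarith) h)
    · linarith [le_csSup hbdd h2]
  · rintro ⟨h1, h2⟩
    refine ⟨⟨r - sSup R, by linarith, by linarith, ?_⟩, fun h => ?_⟩
    · rw [sub_sub_cancel]; exact hb
    · exact absurd (le_csSup hbdd h) (not_le.2 h1)

/-- On each line parallel to `v a`, the points gained by adding the generator form a half-open
interval of length 1, which contains exactly one point of each class modulo `ℤ v a`. So the new
orbits correspond to the orbits after `v a` is contracted into `B`. -/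
theorem orbitCount_insert_of_notMem {v : ι → E} {L : AddSubgroup E} (hv : ∀ i, v i ∈ L)
    {A B : Finset ι} {a : ι} (ha : a ∉ A) (hB : v a ∉ Submodule.span ℝ (v '' B)) :
    orbitCount v L (insert a A) B = orbitCount v L A B + orbitCount v L A (insert a B) := by
  let S := zonotopeAddSpan v A B
  let S' := zonotopeAddSpan v (insert a A) B
  let T := zonotopeAddSpan v A (insert a B)
  let H := AddSubgroup.closure (v '' B)
  let H' := AddSubgroup.closure (v '' (insert a B : Finset ι))
  have hSS' : S ⊆ S' := fun x hx =>
    (mem_zonotopeAddSpan_insert_left ha).2 ⟨0, le_rfl, zero_le_one, by simpa using hx⟩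
  have hS'T : S' ⊆ T := fun x hx => by
    obtain ⟨θ, -, -, h⟩ := (mem_zonotopeAddSpan_insert_left ha).1 hx
    exact mem_zonotopeAddSpan_insert_right.2 ⟨-θ, by simpa [sub_eq_add_neg] using h⟩
  have hHH' : H ≤ H' := AddSubgroup.closure_mono (Set.image_mono (by simp))
  have hsub : ∀ {x y : E}, -x + y ∈ H → y - x ∈ Submodule.span ℝ (v '' B) := fun {x y} h =>
    closure_le_span v B (by rwa [sub_eq_neg_add])
  have h1 : orbitCount v L (insert a A) B = orbitCount v L A B +
      ((QuotientAddGroup.mk : E → E ⧸ H) '' ((S' \ S) ∩ L)).encard := by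
    rw [orbitCount, orbitCount, ← Set.encard_union_eq, ← Set.image_union,
      ← Set.union_inter_distrib_right, Set.union_sdiff_cancel hSS']
    rw [Set.disjoint_left]
    rintro _ ⟨x, hx, rfl⟩ ⟨y, hy, hxy⟩
    have := hsub (QuotientAddGroup.eq.1 hxy.symm)
    exact hy.1.2 ((mem_zonotopeAddSpan_congr this).2 hx.1)
  rw [h1]
  congr 1
  let π : E ⧸ H → E ⧸ H' := QuotientAddGroup.map H H' (AddMonoidHom.id E) hHH'
  have hπ : ∀ x : E, π (QuotientAddGroup.mk x) = QuotientAddGroup.mk x := fun x => rfl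
  have himg : (QuotientAddGroup.mk : E → E ⧸ H') '' (T ∩ L) =
      π '' ((QuotientAddGroup.mk : E → E ⧸ H) '' ((S' \ S) ∩ L)) := by
    rw [Set.image_image]
    ext q
    constructor
    · rintro ⟨y, ⟨hyT, hyL⟩, rfl⟩
      obtain ⟨b, hb⟩ := exists_line_inter_eq_Ioc ha hB hyT
      -- `⌊b⌋ + 1` is the unique integer in `(b, b + 1]`.
      have h2 := (hb ((⌊b⌋ + 1 : ℤ) : ℝ)).2 (by
        push_cast
        exact ⟨Int.lt_floor_add_one b, by linarith [Int.floor_le b]⟩)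
      refine ⟨y + ((⌊b⌋ + 1 : ℤ) : ℝ) • v a, ⟨h2, ?_⟩, ?_⟩
      · rw [Int.cast_smul_eq_zsmul]
        exact L.add_mem hyL (L.zsmul_mem (hv a) _)
      · refine (QuotientAddGroup.eq.2 ?_).symm
        rw [AddMonoidHom.id_apply, neg_add_cancel_left]
        exact mem_closure_insert.2 ⟨0, AddSubgroup.zero_mem _, _, (zero_add _).symm⟩
    · rintro ⟨x, ⟨hx, hxL⟩, rfl⟩
      exact ⟨x, ⟨hS'T hx.1, hxL⟩, rfl⟩
  have hinj : Set.InjOn π ((QuotientAddGroup.mk : E → E ⧸ H) '' ((S' \ S) ∩ L)) := by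
    rintro _ ⟨x, ⟨hx, hxL⟩, rfl⟩ _ ⟨y, ⟨hy, hyL⟩, rfl⟩ hxy
    rw [hπ, hπ, QuotientAddGroup.eq] at hxy
    obtain ⟨h, hh, k, hk⟩ := mem_closure_insert.1 hxy
    obtain ⟨b, hb⟩ := exists_line_inter_eq_Ioc ha hB (hS'T hx.1)
    have h0 := (hb 0).1 (by simpa using hx)
    have hspan : y - (x + (k : ℝ) • v a) ∈ Submodule.span ℝ (v '' B) := by
      have : y - (x + (k : ℝ) • v a) = h := by
        rw [← sub_sub, sub_eq_neg_add y x, hk, add_sub_cancel_right]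
      rw [this]
      exact closure_le_span v B hh
    have h2 := (hb k).1 ⟨(mem_zonotopeAddSpan_congr hspan).1 hy.1,
      fun h => hy.2 ((mem_zonotopeAddSpan_congr hspan).2 h)⟩
    have h3 : k < 1 := by exact_mod_cast (by linarith [h0.1, h2.2] : (k : ℝ) < 1)
    have h4 : -1 < k := by exact_mod_cast (by linarith [h0.2, h2.1] : (-1 : ℝ) < k)
    have hk0 : k = 0 := by omega
    rw [QuotientAddGroup.eq, hk, hk0]
    simpa using hh
  rw [orbitCount, himg, hinj.encard_image]

open Classical in
-- Unrolling the recursion: each generator of `A` is either deleted or moved to `B`, and the sets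
-- `I` record the moved ones. A generator in the span of `B` can only be deleted, which matches the
-- vanishing terms.
theorem orbitCount_eq_sum {v : ι → E} {L : AddSubgroup E} (hv : ∀ i, v i ∈ L) (A : Finset ι) :
    ∀ B : Finset ι, Disjoint A B → LinearIndepOn ℝ v (B : Set ι) → orbitCount v L A B =
      ∑ I ∈ A.powerset, if LinearIndepOn ℝ v ((I ∪ B : Finset ι) : Set ι) then
        boxCount v L (I ∪ B) else 0 := by
  induction A using Finset.induction_on with
  | empty =>
    intro B _ hB
    simp only [Finset.powerset_empty, Finset.sum_singleton, Finset.empty_union, if_pos hB]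
    exact orbitCount_empty hv hB
  | insert a A ha ih =>
    intro B hAB hB
    rw [Finset.disjoint_insert_left] at hAB
    rw [Finset.sum_powerset_insert ha, ← ih B hAB.2 hB]
    have hun : ∀ I : Finset ι, insert a I ∪ B = I ∪ insert a B := fun I => by
      rw [Finset.insert_union, Finset.union_insert]
    simp only [hun]
    by_cases h : v a ∈ Submodule.span ℝ (v '' B)
    · rw [orbitCount_insert_of_mem ha h, Finset.sum_eq_zero, add_zero]
      intro I _
      rw [if_neg]
      intro hI
      have : LinearIndepOn ℝ v (insert a (B : Set ι)) := hI.mono (by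
        rw [← Finset.coe_insert]; exact Finset.coe_subset.2 Finset.subset_union_right)
      exact this.notMem_span_of_insert (by simpa using hAB.1) h
    · rw [orbitCount_insert_of_notMem hv ha h, ih (insert a B)
        (Finset.disjoint_insert_right.2 ⟨ha, hAB.2⟩)
        (by rw [Finset.coe_insert]; exact hB.insert h)]

open Classical in
/-- The lattice points of a lattice zonotope are counted by the half-open parallelepipeds
spanned by the linearly independent subsets of its generators. -/
theorem encard_zonotope_inter [Fintype ι] {v : ι → E} {L : AddSubgroup E} (hv : ∀ i, v i ∈ L) :
    ({x | ∃ α : ι → ℝ, (∀ i, 0 ≤ α i ∧ α i ≤ 1) ∧ x = ∑ i, α i • v i} ∩ (L : Set E)).encard =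
      ∑ I : Finset ι, if LinearIndepOn ℝ v (I : Set ι) then boxCount v L I else 0 := by
  have h := orbitCount_eq_sum hv Finset.univ ∅ (Finset.disjoint_empty_right _) (by simp)
  simp only [Finset.union_empty, Finset.powerset_univ] at h
  rw [← h, orbitCount, Function.Injective.encard_image]
  · congr 2
    ext x
    simp [zonotopeAddSpan, sub_eq_zero]
  · intro x y hxy
    have := QuotientAddGroup.eq.1 hxy
    simp only [Finset.coe_empty, Set.image_empty, AddSubgroup.closure_empty,
      AddSubgroup.mem_bot] at this
    exact (neg_add_eq_zero.1 this)

end DeletionContraction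

/-! ### The Ehrhart polynomial of a zonotope in general position -/

/-- `integerLattice n` as a subgroup of `ℝⁿ`. -/
def integerSubgroup (n : ℕ) : AddSubgroup (Fin n → ℝ) where
  carrier := integerLattice n
  zero_mem' := fun _ => ⟨0, by simp⟩
  add_mem' := fun {x y} hx hy j => by
    obtain ⟨a, ha⟩ := hx j
    obtain ⟨b, hb⟩ := hy j
    exact ⟨a + b, by simp [ha, hb]⟩
  neg_mem' := fun {x} hx j => by
    obtain ⟨a, ha⟩ := hx j
    exact ⟨-a, by simp [ha]⟩

theorem toReal_mem {n : ℕ} (z : Fin n → ℤ) : toReal z ∈ integerSubgroup n :=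
  fun j => ⟨z j, rfl⟩

/-- The dilated half-open parallelepiped is tiled by `k ^ I.card` translates of the original by
vectors of `L`; splitting `k * β i` into integer and fractional part gives the bijection. -/
theorem boxCount_natCast_smul {E ι : Type*} [NormedAddCommGroup E] [NormedSpace ℝ E]
    {v : ι → E} {L : AddSubgroup E} (hv : ∀ i, v i ∈ L) {k : ℕ} (hk : 0 < k) (I : Finset ι) :
    boxCount (fun i => (k : ℝ) • v i) L I = (k : ℕ∞) ^ I.card * boxCount v L I := by
  have hk0 : (0 : ℝ) < k := by exact_mod_cast hk
  have hcard : (Set.univ : Set (I → Fin k)).encard = (k : ℕ∞) ^ I.card := by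
    rw [Set.encard_univ]; simp
  have hz : ∀ z : I → Fin k, ∑ i, ((z i : ℕ) : ℝ) • v i ∈ L := fun z =>
    L.sum_mem fun i _ => by rw [Nat.cast_smul_eq_nsmul]; exact L.nsmul_mem (hv i) _
  rw [boxCount, boxCount, ← hcard, ← Set.encard_prod]
  symm
  rw [← Set.InjOn.encard_image (f := fun p : (I → Fin k) × (I → ℝ) =>
    fun i => (((p.1 i : ℕ) : ℝ) + p.2 i) / k)]
  · congr 1
    ext β
    constructor
    · rintro ⟨⟨z, γ⟩, ⟨-, hγ, hγL⟩, rfl⟩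
      refine ⟨fun i => ⟨?_, ?_⟩, ?_⟩
      · have := (hγ i).1; positivity
      · have h1 : ((z i : ℕ) : ℝ) + 1 ≤ k := by exact_mod_cast (z i).2
        rw [div_lt_one hk0]
        linarith [(hγ i).2]
      · have : ∑ i, ((((z i : ℕ) : ℝ) + γ i) / k) • (k : ℝ) • v i =
            ∑ i, ((z i : ℕ) : ℝ) • v i + ∑ i, γ i • v i := by
          rw [← Finset.sum_add_distrib]
          refine Finset.sum_congr rfl fun i _ => ?_
          rw [smul_smul, div_mul_cancel₀ _ hk0.ne', add_smul]
        exact this ▸ L.add_mem (hz z) hγL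
    · rintro ⟨hβ, hβL⟩
      have hnn : ∀ i, 0 ≤ k * β i := fun i => mul_nonneg hk0.le (hβ i).1
      let z : I → Fin k := fun i => ⟨⌊k * β i⌋₊, by
        rw [Nat.floor_lt (hnn i)]
        exact mul_lt_of_lt_one_right hk0 (hβ i).2⟩
      refine ⟨(z, fun i => k * β i - ((z i : ℕ) : ℝ)), ⟨trivial, fun i => ⟨?_, ?_⟩, ?_⟩, ?_⟩
      · exact sub_nonneg.2 (Nat.floor_le (hnn i))
      · have := Nat.lt_floor_add_one (k * β i)
        change k * β i - (⌊k * β i⌋₊ : ℝ) < 1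
        linarith
      · have : ∑ i, (k * β i - ((z i : ℕ) : ℝ)) • v i =
            ∑ i, β i • (k : ℝ) • v i - ∑ i, ((z i : ℕ) : ℝ) • v i := by
          rw [← Finset.sum_sub_distrib]
          refine Finset.sum_congr rfl fun i _ => ?_
          rw [smul_smul, sub_smul, mul_comm]
        exact this ▸ L.sub_mem hβL (hz z)
      · funext i
        simp only [add_sub_cancel]
        field_simp
  · rintro ⟨z, γ⟩ ⟨-, hγ, -⟩ ⟨w, δ⟩ ⟨-, hδ, -⟩ h
    have h1 : ∀ i, ((z i : ℕ) : ℝ) + γ i = ((w i : ℕ) : ℝ) + δ i := fun i => by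
      have := congrFun h i
      simpa [div_left_inj' hk0.ne'] using this
    have h2 : ∀ i, z i = w i := fun i => by
      have a1 : ((z i : ℕ) : ℝ) < (w i : ℕ) + 1 := by linarith [h1 i, (hγ i).1, (hδ i).2]
      have a2 : ((w i : ℕ) : ℝ) < (z i : ℕ) + 1 := by linarith [h1 i, (hδ i).1, (hγ i).2]
      have a1' : (z i : ℕ) < (w i : ℕ) + 1 := by exact_mod_cast a1
      have a2' : (w i : ℕ) < (z i : ℕ) + 1 := by exact_mod_cast a2
      exact Fin.ext (by omega)
    refine Prod.ext (funext h2) (funext fun i => ?_)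
    have := h1 i
    rw [h2 i] at this
    exact add_left_cancel this

theorem linearIndepOn_smul_iff {E ι : Type*} [AddCommGroup E] [Module ℝ E]
    {v : ι → E} {c : ℝ} (hc : c ≠ 0) {s : Set ι} :
    LinearIndepOn ℝ (fun i => c • v i) s ↔ LinearIndepOn ℝ v s :=
  LinearMap.linearIndepOn_iff_of_injOn (LinearMap.lsmul ℝ E c)
    (fun _ _ _ _ h => smul_right_injective E hc h)

theorem linearIndepOn_iff_card_le {m n : ℕ} {v : Fin m → Fin n → ℤ} (hv : InGeneralPosition v)
    (hmn : n ≤ m) (I : Finset (Fin m)) :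
    LinearIndepOn ℝ (fun i => toReal (v i)) (I : Set (Fin m)) ↔ I.card ≤ n := by
  constructor
  · intro h
    have := LinearIndependent.fintype_card_le_finrank h
    simpa using this
  · intro h
    obtain ⟨J, hIJ, hJ⟩ := Finset.exists_superset_card_eq h (by simpa using hmn)
    have : LinearIndepOn ℝ (fun i => toReal (v i)) (J : Set (Fin m)) := hv J hJ
    exact this.mono (Finset.coe_subset.2 hIJ)

theorem smul_zonotope {m n : ℕ} (v : Fin m → Fin n → ℤ) (k : ℝ) :
    k • zonotope v = {x | ∃ α : Fin m → ℝ, (∀ i, 0 ≤ α i ∧ α i ≤ 1) ∧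
      x = ∑ i, α i • (k • toReal (v i))} := by
  have h : ∀ α : Fin m → ℝ, ∑ i, α i • (k • toReal (v i)) = k • ∑ i, α i • toReal (v i) :=
    fun α => by rw [Finset.smul_sum]; exact Finset.sum_congr rfl fun i _ => smul_comm _ _ _
  ext x
  constructor
  · rintro ⟨_, ⟨α, hα, rfl⟩, rfl⟩
    exact ⟨α, hα, (h α).symm⟩
  · rintro ⟨α, hα, rfl⟩
    exact ⟨_, ⟨α, hα, rfl⟩, (h α).symm⟩

open Classical in
theorem isEhrhartPolynomial_zonotope {m n : ℕ} {v : Fin m → Fin n → ℤ}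
    (hv : InGeneralPosition v) (hmn : n ≤ m)
    (hfin : ∀ I : Finset (Fin m), I.card ≤ n →
      boxCount (fun i => toReal (v i)) (integerSubgroup n) I ≠ ⊤) :
    IsEhrhartPolynomial (zonotope v) (∑ i ∈ Finset.range (n + 1), Polynomial.C
      (∑ I ∈ (Finset.univ : Finset (Fin m)).powersetCard i,
        ((boxCount (fun i => toReal (v i)) (integerSubgroup n) I).toNat : ℝ)) *
      Polynomial.X ^ i) := by
  intro k
  simp only [Polynomial.eval_finsetSum, Polynomial.eval_mul, Polynomial.eval_C,
    Polynomial.eval_pow, Polynomial.eval_X]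
  -- For `k = 0` the scaled generators vanish and are no longer independent, so this case is checked
  -- directly: only the empty box contributes.
  rcases Nat.eq_zero_or_pos k with rfl | hk
  · have hne : (zonotope v).Nonempty := ⟨0, 0, fun i => by simp, by simp⟩
    have h1 : ({0} : Set (Fin n → ℝ)) ∩ integerLattice n = {0} :=
      Set.inter_eq_left.2 (Set.singleton_subset_iff.2 (integerSubgroup n).zero_mem)
    have h2 : boxCount (fun i => toReal (v i)) (integerSubgroup n) ∅ = 1 := by
      rw [boxCount, Set.encard_eq_one]
      refine ⟨0, Set.eq_singleton_iff_unique_mem.2 ⟨⟨fun i => ?_, ?_⟩, fun y _ => ?_⟩⟩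
      · exact absurd i.2 (Finset.notMem_empty _)
      · simp
      · funext i
        exact absurd i.2 (Finset.notMem_empty _)
    rw [Nat.cast_zero, Set.zero_smul_set hne, ← Set.singleton_zero, latticePointCount, h1,
      Finset.sum_eq_single 0]
    · simp [h2]
    · intro i _ hi
      rw [zero_pow hi, mul_zero]
    · simp
  · have hk0 : (k : ℝ) ≠ 0 := by exact_mod_cast hk.ne'
    have h := encard_zonotope_inter (v := fun i => (k : ℝ) • toReal (v i))
      (L := integerSubgroup n) (fun i => by
        rw [Nat.cast_smul_eq_nsmul]
        exact (integerSubgroup n).nsmul_mem (toReal_mem _) _)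
    rw [← smul_zonotope] at h
    simp only [linearIndepOn_smul_iff hk0, linearIndepOn_iff_card_le hv hmn,
      boxCount_natCast_smul (fun i => toReal_mem (v i)) hk] at h
    have h3 : latticePointCount ((k : ℝ) • zonotope v) = ∑ I : Finset (Fin m),
        if I.card ≤ n then k ^ I.card *
          (boxCount (fun i => toReal (v i)) (integerSubgroup n) I).toNat else 0 := by
      rw [latticePointCount, Set.ncard_def]
      change (((k : ℝ) • zonotope v) ∩ (integerSubgroup n : Set (Fin n → ℝ))).encard.toNat = _
      rw [h, ENat.toNat_sum]
      · refine Finset.sum_congr rfl fun I _ => ?_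
        split_ifs with hI
        · rw [ENat.toNat_mul]
          congr 1
        · rfl
      · intro I _
        split_ifs with hI
        · obtain ⟨b, hb⟩ := ENat.ne_top_iff_exists.1 (hfin I hI)
          rw [← hb]
          exact_mod_cast ENat.natCast_ne_top (k ^ I.card * b)
        · exact ENat.zero_ne_top
    rw [h3, ← Finset.sum_filter, ← Finset.sum_fiberwise_of_maps_to
      (t := Finset.range (n + 1)) (g := Finset.card) (by simp)]
    push_cast
    refine Finset.sum_congr rfl fun i hi => ?_
    rw [Finset.sum_mul]
    refine Finset.sum_congr ?_ fun I hI => ?_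
    · ext I
      have := Finset.mem_range.1 hi
      simp only [Finset.mem_filter, Finset.mem_univ, true_and, Finset.mem_powersetCard,
        Finset.subset_univ]
      omega
    · rw [(Finset.mem_powersetCard.1 hI).2, mul_comm]

theorem IsEhrhartPolynomial.eq {n : ℕ} {P : Set (Fin n → ℝ)} {p q : Polynomial ℝ}
    (hp : IsEhrhartPolynomial P p) (hq : IsEhrhartPolynomial P q) : p = q := by
  refine Polynomial.eq_of_infinite_eval_eq p q
    ((Set.infinite_range_of_injective (Nat.cast_injective (R := ℝ))).mono ?_)
  rintro _ ⟨k, rfl⟩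
  exact (hp k).symm.trans (hq k)

theorem IsEhrhartPolynomial.ehrhartPolynomial_eq {n : ℕ} {P : Set (Fin n → ℝ)}
    {p : Polynomial ℝ} (hp : IsEhrhartPolynomial P p) : ehrhartPolynomial P = p := by
  have h : ∃ p, IsEhrhartPolynomial P p := ⟨p, hp⟩
  rw [ehrhartPolynomial, dif_pos h]
  exact h.choose_spec.eq hp

/-! ### Successive minima of the difference body and their flag -/

section Minima

variable {m n : ℕ} {v : Fin m → Fin n → ℤ}

theorem mem_smul_zonotope_sub_iff {t : ℝ} (ht : 0 < t) {x : Fin n → ℝ} :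
    x ∈ t • (zonotope v - zonotope v) ↔
      ∃ γ : Fin m → ℝ, (∀ i, |γ i| ≤ t) ∧ x = ∑ i, γ i • toReal (v i) := by
  constructor
  · rintro ⟨_, ⟨_, ⟨α, hα, rfl⟩, _, ⟨β, hβ, rfl⟩, rfl⟩, rfl⟩
    refine ⟨fun i => t * (α i - β i), fun i => ?_, ?_⟩
    · rw [abs_mul, abs_of_pos ht]
      refine mul_le_of_le_one_right ht.le (abs_le.2 ⟨?_, ?_⟩) <;>
        linarith [(hα i).1, (hα i).2, (hβ i).1, (hβ i).2]
    · simp only [← Finset.sum_sub_distrib, Finset.smul_sum, ← sub_smul, smul_smul]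
  · rintro ⟨γ, hγ, rfl⟩
    have h : ∀ i, |γ i / t| ≤ 1 := fun i => by
      rw [abs_div, abs_of_pos ht, div_le_one ht]; exact hγ i
    refine ⟨_, ⟨∑ i, max (γ i / t) 0 • toReal (v i), ⟨_, fun i => ⟨le_max_right _ _, ?_⟩, rfl⟩,
      ∑ i, max (-(γ i / t)) 0 • toReal (v i), ⟨_, fun i => ⟨le_max_right _ _, ?_⟩, rfl⟩, rfl⟩, ?_⟩
    · exact max_le (abs_le.1 (h i)).2 zero_le_one
    · exact max_le (by linarith [(abs_le.1 (h i)).1]) zero_le_one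
    · simp only [← Finset.sum_sub_distrib, Finset.smul_sum, ← sub_smul, smul_smul]
      refine Finset.sum_congr rfl fun i _ => ?_
      have : max (γ i / t) 0 - max (-(γ i / t)) 0 = γ i / t := by
        rcases le_total 0 (γ i / t) with h0 | h0
        · rw [max_eq_left h0, max_eq_right (by linarith), sub_zero]
        · rw [max_eq_right h0, max_eq_left (by linarith)]; ring
      rw [this, mul_div_cancel₀ _ ht.ne']

/-- The lattice points of `t (Z - Z)`. -/
def dilateInter (v : Fin m → Fin n → ℤ) (t : ℝ) : Set (Fin n → ℝ) :=
  t • (zonotope v - zonotope v) ∩ integerLattice n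

theorem dilateInter_mono {s t : ℝ} (hs : 0 < s) (hst : s ≤ t) :
    dilateInter v s ⊆ dilateInter v t := by
  rintro x ⟨hx, hxL⟩
  obtain ⟨γ, hγ, rfl⟩ := (mem_smul_zonotope_sub_iff hs).1 hx
  exact ⟨(mem_smul_zonotope_sub_iff (hs.trans_le hst)).2
    ⟨γ, fun i => (hγ i).trans hst, rfl⟩, hxL⟩

theorem affineDim_dilateInter {t : ℝ} (ht : 0 < t) :
    affineDim (dilateInter v t) =
      Module.finrank ℝ (Submodule.span ℝ (dilateInter v t)) := by
  have h0 : (0 : Fin n → ℝ) ∈ dilateInter v t :=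
    ⟨(mem_smul_zonotope_sub_iff ht).2 ⟨0, fun i => by simpa using ht.le, by simp⟩,
      (integerSubgroup n).zero_mem⟩
  have h1 : (fun x : Fin n → ℝ => x -ᵥ (0 : Fin n → ℝ)) '' dilateInter v t = dilateInter v t := by
    simp
  rw [affineDim, direction_affineSpan, vectorSpan_eq_span_vsub_set_right ℝ h0, h1]

/-- The successive minima of `Z - Z`, numbered from `0`. -/
noncomputable def differenceMinimum (v : Fin m → Fin n → ℤ) (k : ℕ) : ℝ :=
  successiveMinimum (k + 1) (zonotope v - zonotope v)

theorem bddBelow_minima (k : ℕ) :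
    BddBelow {t : ℝ | 0 < t ∧ k ≤ affineDim (dilateInter v t)} :=
  ⟨0, fun _ h => h.1.le⟩

theorem le_affineDim_one (hv : InGeneralPosition v) (hmn : n ≤ m) :
    n ≤ affineDim (dilateInter v 1) := by
  obtain ⟨J, -, hJ⟩ := Finset.exists_superset_card_eq (s := (∅ : Finset (Fin m))) (n := n)
    (by simp) (by simpa using hmn)
  rw [affineDim_dilateInter one_pos]
  have h1 : Submodule.span ℝ (Set.range fun j : J => toReal (v j)) = ⊤ :=
    (hv J hJ).span_eq_top_of_card_eq_finrank' (by simp [hJ])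
  have h2 : Set.range (fun j : J => toReal (v j)) ⊆ dilateInter v 1 := by
    rintro _ ⟨j, rfl⟩
    refine ⟨(mem_smul_zonotope_sub_iff one_pos).2 ⟨Pi.single (j : Fin m) 1, fun i => ?_, ?_⟩,
      toReal_mem _⟩
    · by_cases h : i = j
      · subst h; simp
      · simp [h]
    · rw [Finset.sum_eq_single (j : Fin m)] <;> simp +contextual
  have h3 := Submodule.span_mono (R := ℝ) h2
  rw [h1, top_le_iff] at h3
  rw [h3]; simp

theorem differenceMinimum_le_succ (hv : InGeneralPosition v) (hmn : n ≤ m) {k : ℕ}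
    (hk : k + 1 < n) : differenceMinimum v k ≤ differenceMinimum v (k + 1) :=
  csInf_le_csInf (bddBelow_minima _) ⟨1, one_pos, (Nat.succ_le_of_lt hk).trans (le_affineDim_one hv hmn)⟩
    fun _ h => ⟨h.1, (Nat.le_succ _).trans h.2⟩

theorem differenceMinimum_mono (hv : InGeneralPosition v) (hmn : n ≤ m) {k l : ℕ} (hkl : k ≤ l)
    (hl : l < n) : differenceMinimum v k ≤ differenceMinimum v l := by
  induction l, hkl using Nat.le_induction with
  | base => rfl
  | succ l _ ih => exact (ih (by omega)).trans (differenceMinimum_le_succ hv hmn hl)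

theorem differenceMinimum_pos (hv : InGeneralPosition v) (hmn : n ≤ m) {k : ℕ} (hk : k < n) :
    0 < differenceMinimum v k := by
  refine lt_of_lt_of_le ?_ (differenceMinimum_mono hv hmn (Nat.zero_le k) hk)
  -- A nonzero integer point has a coordinate of size at least 1, while coordinates in `t (Z - Z)`
  -- are at most `t` times the double sum. The summand 1 makes `M` positive.
  let M : ℝ := ∑ i, ∑ j, |toReal (v i) j| + 1
  have hM : 0 < M := by positivity
  refine lt_of_lt_of_le (one_div_pos.2 hM) (le_csInf
    ⟨1, one_pos, (Nat.succ_le_of_lt (by omega)).trans (le_affineDim_one hv hmn)⟩ ?_)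
  rintro t ⟨ht, hd⟩
  change 0 + 1 ≤ affineDim (dilateInter v t) at hd
  rw [affineDim_dilateInter ht] at hd
  have hx : ∃ x ∈ dilateInter v t, x ≠ 0 := by
    by_contra! h
    have : Submodule.span ℝ (dilateInter v t) = ⊥ := Submodule.span_eq_bot.2 h
    rw [this] at hd
    simp at hd
  obtain ⟨x, ⟨hx, hxL⟩, hx0⟩ := hx
  obtain ⟨γ, hγ, rfl⟩ := (mem_smul_zonotope_sub_iff ht).1 hx
  obtain ⟨j, hj⟩ := Function.ne_iff.1 hx0
  obtain ⟨z, hz⟩ := hxL j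
  have h1 : (1 : ℝ) ≤ |(∑ i, γ i • toReal (v i)) j| := by
    rw [hz] at hj ⊢
    have : z ≠ 0 := by simpa using hj
    exact_mod_cast Int.one_le_abs this
  have h2 : |(∑ i, γ i • toReal (v i)) j| ≤ t * ∑ i, ∑ j, |toReal (v i) j| := by
    rw [Finset.sum_apply, Finset.mul_sum]
    refine (Finset.abs_sum_le_sum_abs _ _).trans (Finset.sum_le_sum fun i _ => ?_)
    rw [Pi.smul_apply, smul_eq_mul, abs_mul]
    exact mul_le_mul (hγ i) (Finset.single_le_sum (f := fun j => |toReal (v i) j|)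
      (fun _ _ => abs_nonneg _) (Finset.mem_univ j)) (abs_nonneg _) ht.le
  rw [div_le_iff₀ hM]
  simp only [M]
  linarith

/-- The span of the lattice points of the dilates `t (Z - Z)` with `t` below the `k`-th minimum. -/
def minimaFlag (v : Fin m → Fin n → ℤ) (k : ℕ) : Submodule ℝ (Fin n → ℝ) :=
  Submodule.span ℝ {x | ∃ t, 0 < t ∧ t < differenceMinimum v k ∧ x ∈ dilateInter v t}

theorem minimaFlag_mono (hv : InGeneralPosition v) (hmn : n ≤ m) {k l : ℕ} (hkl : k ≤ l)
    (hl : l < n) : minimaFlag v k ≤ minimaFlag v l :=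
  Submodule.span_mono fun _ ⟨t, h0, h1, h2⟩ =>
    ⟨t, h0, h1.trans_le (differenceMinimum_mono hv hmn hkl hl), h2⟩

/-- Finitely many of the generating points span, and the dilates are nested, so one `t` below the
minimum numbered `k` from 0 captures them all; rank `k + 1` would contradict the infimum. -/
theorem finrank_minimaFlag_le (k : ℕ) : Module.finrank ℝ (minimaFlag v k) ≤ k := by
  obtain ⟨s, hs, hspan⟩ := (Submodule.fg_span_iff_fg_span_finset_subset _).1
    (IsNoetherian.noetherian (minimaFlag v k))
  change minimaFlag v k = _ at hspan
  rcases s.eq_empty_or_nonempty with rfl | hne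
  · rw [hspan, Finset.coe_empty, Submodule.span_empty, finrank_bot]
    exact Nat.zero_le k
  · have hs' : ∀ x ∈ s, ∃ t, 0 < t ∧ t < differenceMinimum v k ∧ x ∈ dilateInter v t :=
      fun x hx => hs hx
    choose! t ht0 ht1 ht using hs'
    obtain ⟨x, hx, hmax⟩ := s.exists_max_image t hne
    have h1 : minimaFlag v k ≤ Submodule.span ℝ (dilateInter v (t x)) := by
      rw [hspan]
      exact Submodule.span_mono fun y hy => dilateInter_mono (ht0 y hy) (hmax y hy) (ht y hy)
    refine (Submodule.finrank_mono h1).trans ?_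
    rw [← affineDim_dilateInter (ht0 x hx)]
    by_contra! h
    exact absurd (csInf_le (bddBelow_minima (k + 1)) ⟨ht0 x hx, h⟩) (not_le.2 (ht1 x hx))

theorem mem_minimaFlag {k : ℕ} (hpos : 0 < differenceMinimum v k) (γ : Fin m → ℝ)
    (hγ : ∀ i, |γ i| < differenceMinimum v k)
    (hL : ∑ i, γ i • toReal (v i) ∈ integerSubgroup n) :
    ∑ i, γ i • toReal (v i) ∈ minimaFlag v k := by
  have h1 : ‖γ‖ < differenceMinimum v k := (pi_norm_lt_iff hpos).2 hγ
  -- Half the minimum serves only to keep the dilation factor positive when `γ = 0`.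
  have h0 : 0 < max (differenceMinimum v k / 2) ‖γ‖ := lt_max_of_lt_left (by positivity)
  exact Submodule.subset_span ⟨max (differenceMinimum v k / 2) ‖γ‖, h0,
    max_lt (by linarith) h1, (mem_smul_zonotope_sub_iff h0).2
      ⟨γ, fun i => (norm_le_pi_norm γ i).trans (le_max_right _ _), rfl⟩, hL⟩

end Minima

/-! ### Ordering a spanning family against a flag -/

section Flag

variable {E ι : Type*} [AddCommGroup E] [Module ℝ E]

/-- Choose `c (n - 1)`, `c (n - 2)`, … in descending order. At index `k` the forbidden space has
dimension at most `k + (n - k - 1) < n`, so some member of the spanning family avoids it. -/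
theorem exists_flag_complement [FiniteDimensional ℝ E] {n : ℕ} (hn : Module.finrank ℝ E = n) [Nonempty ι]
    {u : ι → E} (hu : Submodule.span ℝ (Set.range u) = ⊤)
    {W : ℕ → Submodule ℝ E} (hW : ∀ k < n, Module.finrank ℝ (W k) ≤ k) :
    ∃ c : ℕ → ι, ∀ k < n, u (c k) ∉ W k ⊔
      Submodule.span ℝ ((fun l => u (c l)) '' (Finset.Ioo k n : Set ℕ)) := by
  suffices h : ∀ j ≤ n, ∃ c : ℕ → ι, ∀ k, n - j ≤ k → k < n → u (c k) ∉ W k ⊔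
      Submodule.span ℝ ((fun l => u (c l)) '' (Finset.Ioo k n : Set ℕ)) by
    obtain ⟨c, hc⟩ := h n le_rfl
    exact ⟨c, fun k hk => hc k (by omega) hk⟩
  intro j
  induction j with
  | zero => exact fun _ => ⟨fun _ => Classical.arbitrary ι, fun k h1 h2 => by omega⟩
  | succ j ih =>
    intro hj
    obtain ⟨c, hc⟩ := ih (by omega)
    let k := n - j - 1
    have hk : k < n := by omega
    let X := W k ⊔ Submodule.span ℝ ((fun l => u (c l)) '' (Finset.Ioo k n : Set ℕ))
    have hX : ∃ i, u i ∉ X := by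
      by_contra! h
      have htop : X = ⊤ := top_le_iff.1 (hu ▸ Submodule.span_le.2 (by
        rintro _ ⟨i, rfl⟩; exact h i))
      have h1 : Module.finrank ℝ X = n := by rw [htop, finrank_top, hn]
      have h2 := Submodule.finrank_add_le_finrank_add_finrank (W k)
        (Submodule.span ℝ ((fun l => u (c l)) '' (Finset.Ioo k n : Set ℕ)))
      have h3 : Module.finrank ℝ
          (Submodule.span ℝ ((fun l => u (c l)) '' (Finset.Ioo k n : Set ℕ))) ≤ n - k - 1 := by
        classical
        rw [← Finset.coe_image]
        exact (finrank_span_finset_le_card _).trans (Finset.card_image_le.trans (by simp))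
      have h4 := hW k hk
      change Module.finrank ℝ X ≤ _ at h2
      omega
    obtain ⟨i, hi⟩ := hX
    have himg : ∀ l, k ≤ l → (fun l => u (Function.update c k i l)) '' (Finset.Ioo l n : Set ℕ) =
        (fun l => u (c l)) '' (Finset.Ioo l n : Set ℕ) := fun l hl =>
      Set.image_congr fun a ha => by
        have : a ≠ k := by
          have := (Finset.mem_Ioo.1 (Finset.mem_coe.1 ha)).1
          omega
        rw [Function.update_of_ne this]
    refine ⟨Function.update c k i, fun l h1 h2 => ?_⟩
    rw [himg l (by omega)]
    by_cases hl : l = k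
    · subst hl
      rwa [Function.update_self]
    · rw [Function.update_of_ne hl]
      exact hc l (by omega) h2

theorem injOn_of_flag_complement {n : ℕ} {u : ι → E} {W : ℕ → Submodule ℝ E} {c : ℕ → ι}
    (hc : ∀ k < n, u (c k) ∉ W k ⊔
      Submodule.span ℝ ((fun l => u (c l)) '' (Finset.Ioo k n : Set ℕ))) :
    ∀ k < n, ∀ l < n, c k = c l → k = l := by
  have : ∀ k < n, ∀ l < n, k < l → c k ≠ c l := fun k hk l hl hkl h => hc k hk
    (Submodule.mem_sup_right (Submodule.subset_span ⟨l, by simp [hkl, hl], by simp [h]⟩))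
  intro k hk l hl h
  rcases lt_trichotomy k l with h1 | h1 | h1
  · exact absurd h (this k hk l hl h1)
  · exact h1
  · exact absurd h.symm (this l hl k hk h1)

/-- Otherwise solve for the vector with the first nonzero coefficient, at `l ≥ k`: it would lie in
`W l` plus the span of the later vectors. -/
theorem eq_zero_of_sum_mem_flag {n : ℕ} {u : ι → E} {W : ℕ → Submodule ℝ E} {c : ℕ → ι}
    (hc : ∀ k < n, u (c k) ∉ W k ⊔
      Submodule.span ℝ ((fun l => u (c l)) '' (Finset.Ioo k n : Set ℕ)))
    (hmono : ∀ k l, k ≤ l → l < n → W k ≤ W l) {k : ℕ} (a : ℕ → ℝ)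
    (ha : ∀ l < k, a l = 0) (hmem : ∑ l ∈ Finset.range n, a l • u (c l) ∈ W k) :
    ∀ l < n, a l = 0 := by
  intro l
  induction l using Nat.strong_induction_on with
  | _ l ih =>
    intro hl
    by_contra hne
    have hkl : k ≤ l := by
      by_contra! h
      exact hne (ha l h)
    have h1 : ∑ i ∈ Finset.range n, a i • u (c i) =
        a l • u (c l) + ∑ i ∈ Finset.Ioo l n, a i • u (c i) := by
      have hsub : insert l (Finset.Ioo l n) ⊆ Finset.range n := by
        intro i hi
        simp only [Finset.mem_insert, Finset.mem_Ioo, Finset.mem_range] at hi ⊢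
        omega
      rw [← Finset.sum_insert (f := fun i => a i • u (c i)) (by simp), ← Finset.sum_subset hsub]
      intro i hi hi'
      simp only [Finset.mem_insert, Finset.mem_Ioo, Finset.mem_range] at hi hi'
      rw [ih i (by omega) hi, zero_smul]
    refine hc l hl ?_
    have h2 : u (c l) = (a l)⁻¹ • (∑ i ∈ Finset.range n, a i • u (c i) -
        ∑ i ∈ Finset.Ioo l n, a i • u (c i)) := by
      rw [h1, add_sub_cancel_right, smul_smul, inv_mul_cancel₀ hne, one_smul]
    rw [h2]
    refine Submodule.smul_mem _ _ (Submodule.sub_mem _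
      (Submodule.mem_sup_left (hmono k l hkl hl hmem)) (Submodule.mem_sup_right ?_))
    exact Submodule.sum_mem _ fun i hi => Submodule.smul_mem _ _
      (Submodule.subset_span ⟨i, Finset.mem_coe.2 hi, rfl⟩)

end Flag

/-! ### Bounding box counts by successive minima, and averaging -/

variable {m n : ℕ} {v : Fin m → Fin n → ℤ}

theorem exists_flag_enumeration (hv : InGeneralPosition v) (hmn : n ≤ m) (hn : 0 < n)
    {J : Finset (Fin m)} (hJ : J.card = n) :
    ∃ c : Fin n ↪ Fin m, Finset.univ.map c = J ∧
      ∀ k < n, ∀ a : Fin n → ℝ, (∀ l : Fin n, (l : ℕ) < k → a l = 0) →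
        ∑ l, a l • toReal (v (c l)) ∈ minimaFlag v k → a = 0 := by
  have hne : Nonempty J := (Finset.card_pos.1 (by omega)).to_subtype
  have hspan : Submodule.span ℝ (Set.range fun j : J => toReal (v j)) = ⊤ :=
    (hv J hJ).span_eq_top_of_card_eq_finrank' (by simp [hJ])
  obtain ⟨c, hc⟩ := exists_flag_complement (n := n) (by simp) hspan
    (W := minimaFlag v) (fun k _ => finrank_minimaFlag_le k)
  have hinj : Function.Injective fun l : Fin n => (c l : Fin m) := fun k l h =>
    Fin.ext (injOn_of_flag_complement (u := fun j : J => toReal (v j)) hc k k.2 l l.2 (Subtype.ext h))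
  refine ⟨⟨_, hinj⟩, Finset.eq_of_subset_of_card_le ?_ (by simp [hJ]), ?_⟩
  · intro i hi
    obtain ⟨l, -, rfl⟩ := Finset.mem_map.1 hi
    exact (c l).2
  · intro k hk a ha hmem
    have h := eq_zero_of_sum_mem_flag hc (fun k l => minimaFlag_mono hv hmn) (k := k)
      (fun l => if h : l < n then a ⟨l, h⟩ else 0)
      (fun l hl => by simp only [dif_pos (hl.trans hk)]; exact ha _ hl) (by
        rw [← Fin.sum_univ_eq_sum_range
          (fun l => (if h : l < n then a ⟨l, h⟩ else 0) • toReal (v (c l)))]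
        simpa using hmem)
    funext l
    simpa using h l l.2

/-- The order of `J` is fixed before `T`; this uniformity lets the sum over subsets of `J` be
compared term by term with the elementary symmetric polynomial. -/
theorem boxCount_mul_prod_le (hv : InGeneralPosition v) (hmn : n ≤ m) (hn : 0 < n)
    {J : Finset (Fin m)} (hJ : J.card = n) :
    ∃ c : Fin n ↪ Fin m, Finset.univ.map c = J ∧ ∀ T : Finset (Fin n),
      boxCount (fun i => toReal (v i)) (integerSubgroup n) (T.map c) ≠ ⊤ ∧
      ((boxCount (fun i => toReal (v i)) (integerSubgroup n) (T.map c)).toNat : ℝ) *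
        ∏ l ∈ T, differenceMinimum v l ≤ 1 := by
  obtain ⟨c, hcJ, hc⟩ := exists_flag_enumeration hv hmn hn hJ
  refine ⟨c, hcJ, fun T => ?_⟩
  -- The position of a generator in the ordering of `J`; the default 0 outside `J` is never used.
  let g : Fin m → ℕ := Function.extend c (fun l => (l : ℕ)) 0
  have hg : ∀ l, g (c l) = l := fun l => c.injective.extend_apply _ _ _
  let I := T.map c
  have hgI : ∀ i ∈ I, ∃ l : Fin n, l ∈ T ∧ c l = i := fun i hi => by simpa [I] using hi
  let Φ : (I → ℝ) →ₗ[ℝ] (Fin n → ℝ) := Fintype.linearCombination ℝ fun i : I => toReal (v i)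
  have hΦ : ∀ x, Φ x = ∑ i, x i • toReal (v i) := fun x => Fintype.linearCombination_apply ..
  let ext : (I → ℝ) → Fin m → ℝ := fun x i => if h : i ∈ I then x ⟨i, h⟩ else 0
  have hext : ∀ x, Φ x = ∑ i, ext x i • toReal (v i) := fun x => by
    rw [hΦ, ← Finset.sum_subset (Finset.subset_univ I), ← Finset.sum_coe_sort I]
    · refine Finset.sum_congr rfl fun i _ => by simp [ext]
    · intro i _ hi
      simp [ext, hi]
  have hextc : ∀ x, Φ x = ∑ l, ext x (c l) • toReal (v (c l)) := fun x => by
    rw [hext, ← Finset.sum_map Finset.univ c (fun i => ext x i • toReal (v i))]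
    refine (Finset.sum_subset (Finset.subset_univ _) fun i _ hi => ?_).symm
    have : i ∉ I := fun h => hi (Finset.map_subset_map.2 (Finset.subset_univ T) h)
    simp [ext, this]
  let L : AddSubgroup (I → ℝ) := (integerSubgroup n).comap Φ.toAddMonoidHom
  let U : ℕ → Submodule ℝ (I → ℝ) := fun k => (minimaFlag v k).comap Φ
  have hU : ∀ k < n, Module.finrank ℝ (U k) ≤ (Finset.univ.filter fun i : I => g i < k).card := by
    intro k hk
    -- A vector of `U k` with zero coordinates in positions below `k` is zero by the choice of `c`,
    -- so `U k` embeds into those coordinates.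
    let R : U k →ₗ[ℝ] ({i : I // g i < k} → ℝ) :=
      (LinearMap.funLeft ℝ ℝ (Subtype.val : {i : I // g i < k} → I)) ∘ₗ (U k).subtype
    have hR : Function.Injective R := by
      rw [← LinearMap.ker_eq_bot, LinearMap.ker_eq_bot']
      rintro ⟨x, hx⟩ h
      have h0 : ∀ i : I, g i < k → x i = 0 := fun i hi => congrFun h ⟨i, hi⟩
      have h1 : Φ x ∈ minimaFlag v k := hx
      rw [hextc] at h1
      have h2 := hc k hk (fun l => ext x (c l)) (fun l hl => by
        simp only [ext]
        split_ifs with h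
        · exact h0 _ (by rw [hg]; exact hl)
        · rfl) h1
      refine Subtype.ext (funext fun i => ?_)
      obtain ⟨l, -, hl⟩ := hgI i i.2
      have h3 := congrFun h2 l
      simp only [ext, hl, dif_pos i.2] at h3
      exact h3
    have := LinearMap.finrank_le_finrank_of_injective hR
    rwa [Module.finrank_fintype_fun_eq_card, Fintype.card_subtype] at this
  have hL : ∀ k < n, ∀ x ∈ L, (∀ i, |x i| < differenceMinimum v k) → x ∈ U k := by
    intro k hk x hx hxk
    have hpos := differenceMinimum_pos hv hmn hk
    change Φ x ∈ minimaFlag v k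
    have hx' : Φ x ∈ integerSubgroup n := hx
    rw [hext] at hx' ⊢
    refine mem_minimaFlag hpos _ (fun i => ?_) hx'
    simp only [ext]
    split_ifs with h
    · exact hxk _
    · simpa using hpos
  -- At the last stage `n - 1` the truncation `min (g i) (n - 1)` is just `g i`.
  obtain ⟨D, hD, -, hDL, hDv⟩ := exists_isSeparated_volume_ge
    (fun k hk => differenceMinimum_pos hv hmn hk)
    (fun k hk => differenceMinimum_le_succ hv hmn hk) (fun i : I => g i) L U hU hL (n - 1)
    (by omega)
  have hprod : ∏ i : I, differenceMinimum v (min (g i) (n - 1)) =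
      ∏ l ∈ T, differenceMinimum v l := by
    rw [Finset.prod_coe_sort I fun i => differenceMinimum v (min (g i) (n - 1)), Finset.prod_map]
    refine Finset.prod_congr rfl fun l _ => ?_
    rw [hg, min_eq_left (by omega)]
  rw [hprod] at hDv
  have hpos : 0 < ∏ l ∈ T, differenceMinimum v l :=
    Finset.prod_pos fun l _ => differenceMinimum_pos hv hmn l.2
  obtain ⟨hfin, hle⟩ := ncard_mul_le_one L (fun x hx => by
    choose z hz using hx
    change Φ x ∈ integerSubgroup n
    rw [hΦ]
    refine AddSubgroup.sum_mem _ fun i _ => ?_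
    rw [hz, Int.cast_smul_eq_zsmul]
    exact AddSubgroup.zsmul_mem _ (toReal_mem _) _) hD hDL hpos hDv
  have hbox : boxCount (fun i => toReal (v i)) (integerSubgroup n) I =
      {x : I → ℝ | (∀ i, 0 ≤ x i ∧ x i < 1) ∧ x ∈ L}.encard := rfl
  rw [hbox, ← Set.ncard_def]
  exact ⟨Set.encard_ne_top_iff.2 hfin, hle⟩

theorem sum_boxCount_le (hv : InGeneralPosition v) (hmn : n ≤ m) (hn : 0 < n)
    {J : Finset (Fin m)} (hJ : J.card = n) (i : ℕ) :
    ∑ I ∈ J.powersetCard i,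
      ((boxCount (fun i => toReal (v i)) (integerSubgroup n) I).toNat : ℝ) ≤
        sigma i (zonotope v) := by
  obtain ⟨c, rfl, hc⟩ := boxCount_mul_prod_le hv hmn hn hJ
  rw [Finset.powersetCard_map, Finset.sum_map, sigma, elementarySymm]
  refine Finset.sum_le_sum fun T _ => ?_
  have hpos : 0 < ∏ l ∈ T, differenceMinimum v l :=
    Finset.prod_pos fun l _ => differenceMinimum_pos hv hmn l.2
  have h : ∏ j ∈ T, 1 / successiveMinimum ((j : ℕ) + 1) (zonotope v - zonotope v) =
      1 / ∏ l ∈ T, differenceMinimum v l := by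
    rw [Finset.prod_div_distrib, Finset.prod_const_one]
    rfl
  rw [h, le_div_iff₀ hpos]
  exact (hc T).2

theorem boxCount_ne_top (hv : InGeneralPosition v) (hmn : n ≤ m) {I : Finset (Fin m)}
    (hI : I.card ≤ n) : boxCount (fun i => toReal (v i)) (integerSubgroup n) I ≠ ⊤ := by
  rcases Nat.eq_zero_or_pos n with rfl | hn
  · obtain rfl : I = ∅ := Finset.card_eq_zero.1 (by omega)
    have : IsEmpty (∅ : Finset (Fin m)) := ⟨fun i => Finset.notMem_empty _ i.2⟩
    exact Set.encard_ne_top_iff.2 (Set.toFinite _)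
  · obtain ⟨J, hIJ, hJ⟩ := Finset.exists_superset_card_eq hI (by simpa using hmn)
    obtain ⟨c, rfl, hc⟩ := boxCount_mul_prod_le hv hmn hn hJ
    obtain ⟨T, -, rfl⟩ := Finset.subset_map_iff.1 hIJ
    exact (hc T).1

theorem le_of_interior_zonotope_nonempty (hZ : (interior (zonotope v)).Nonempty) : n ≤ m := by
  let S := Submodule.span ℝ (Set.range fun i => toReal (v i))
  have hsub : zonotope v ⊆ S := by
    rintro _ ⟨α, -, rfl⟩
    exact S.sum_mem fun i _ => S.smul_mem _ (Submodule.subset_span ⟨i, rfl⟩)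
  have htop : S = ⊤ := S.eq_top_of_nonempty_interior' (hZ.mono (interior_mono hsub))
  have h := finrank_range_le_card (R := ℝ) fun i => toReal (v i)
  change Module.finrank ℝ S ≤ _ at h
  rw [htop] at h
  simpa using h

/-- Double counting: each `I` of size `i` has `(m - i).choose (n - i)` supersets of size `n`. -/
theorem sum_powersetCard_sum_powersetCard {i : ℕ} (hi : i ≤ n) (f : Finset (Fin m) → ℝ) :
    ∑ J ∈ (Finset.univ : Finset (Fin m)).powersetCard n, ∑ I ∈ J.powersetCard i, f I =
      ((m - i).choose (n - i) : ℝ) *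
        ∑ I ∈ (Finset.univ : Finset (Fin m)).powersetCard i, f I := by
  rw [Finset.sum_comm' (t' := (Finset.univ : Finset (Fin m)).powersetCard i)
    (s' := fun I => ((Finset.univ : Finset (Fin m)).powersetCard n).filter (I ⊆ ·)) (by
      intro J I
      simp only [Finset.mem_powersetCard, Finset.subset_univ, true_and, Finset.mem_filter]
      tauto), Finset.mul_sum]
  refine Finset.sum_congr rfl fun I hI => ?_
  have hIc := (Finset.mem_powersetCard.1 hI).2
  rw [Finset.sum_const, Finset.card_filter_powersetCard_subset _ _ _ (Finset.subset_univ _)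
    (by omega), hIc, Finset.card_univ, Fintype.card_fin, nsmul_eq_mul]

end LatticeZonotope

open LatticeZonotope in
theorem mainTheorem5 (m n : ℕ) (v : Fin m → Fin n → ℤ)
    (hv : LatticeZonotope.InGeneralPosition v)
    (hZ : (interior (LatticeZonotope.zonotope v)).Nonempty) :
    (∀ k : ℕ, (LatticeZonotope.latticePointCount ((k : ℝ) • LatticeZonotope.zonotope v) : ℝ) =
      ∑ i ∈ Finset.range (n + 1),
        LatticeZonotope.ehrhartCoeff i (LatticeZonotope.zonotope v) * (k : ℝ) ^ i) ∧
    ∀ i : ℕ, 1 ≤ i → i ≤ n →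
      LatticeZonotope.ehrhartCoeff i (LatticeZonotope.zonotope v) ≤
        ((m.choose i : ℝ) / (n.choose i : ℝ)) *
          LatticeZonotope.sigma i (LatticeZonotope.zonotope v) := by
  have hmn := le_of_interior_zonotope_nonempty hZ
  have hp := isEhrhartPolynomial_zonotope hv hmn fun I hI => boxCount_ne_top hv hmn hI
  let f : Finset (Fin m) → ℝ := fun I =>
    ((boxCount (fun i => toReal (v i)) (integerSubgroup n) I).toNat : ℝ)
  have hcoeff : ∀ i ≤ n, ehrhartCoeff i (zonotope v) =
      ∑ I ∈ (Finset.univ : Finset (Fin m)).powersetCard i, f I := by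
    intro i hi
    rw [ehrhartCoeff, hp.ehrhartPolynomial_eq]
    simp only [Polynomial.finsetSum_coeff, Polynomial.coeff_C_mul_X_pow]
    rw [Finset.sum_ite_eq, if_pos (Finset.mem_range.2 (by omega))]
  refine ⟨fun k => ?_, fun i hi hin => ?_⟩
  · rw [hp k]
    simp only [Polynomial.eval_finsetSum, Polynomial.eval_mul, Polynomial.eval_C,
      Polynomial.eval_pow, Polynomial.eval_X]
    refine Finset.sum_congr rfl fun i hi => ?_
    rw [hcoeff i (by have := Finset.mem_range.1 hi; omega)]
  · rw [hcoeff i hin]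
    have h1 : ((m - i).choose (n - i) : ℝ) *
        ∑ I ∈ (Finset.univ : Finset (Fin m)).powersetCard i, f I ≤
        (m.choose n : ℝ) * sigma i (zonotope v) := by
      rw [← sum_powersetCard_sum_powersetCard hin]
      refine (Finset.sum_le_sum fun J hJ =>
        sum_boxCount_le hv hmn (by omega) (Finset.mem_powersetCard.1 hJ).2 i).trans ?_
      simp
    have h2 : (m.choose n : ℝ) * n.choose i = m.choose i * (m - i).choose (n - i) := by
      exact_mod_cast Nat.choose_mul hin
    have h3 : (0 : ℝ) < n.choose i := by exact_mod_cast Nat.choose_pos hin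
    have h4 : (0 : ℝ) < (m - i).choose (n - i) := by exact_mod_cast Nat.choose_pos (by omega)
    rw [div_mul_eq_mul_div, le_div_iff₀ h3]
    refine le_of_mul_le_mul_left ?_ h4
    calc _ = (((m - i).choose (n - i) : ℝ) *
        ∑ I ∈ (Finset.univ : Finset (Fin m)).powersetCard i, f I) * n.choose i := by ring
      _ ≤ ((m.choose n : ℝ) * sigma i (zonotope v)) * n.choose i := by gcongr
      _ = _ := by linear_combination sigma i (zonotope v) * h2
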